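/- Let the Euler numbers $E_n\in\mathbb{Z}$ be defined by $\sec z=\sum_{n\ge 0}E_n z^n/n!$. For a prime $p$, an integer $\ell$ and real numbers $0\le x<y\le 1$ put $$S_\ell(x,y)=\sum_{xp<s<yp}s^\ell \bmod p,$$ the sum being over integers $s$. The cost of a linear combination $\sum_{i=1}^m c_i S_\ell(x_i,y_i)$ is $p\sum_{i=1}^m(y_i-x_i)$. Let $p\ge 5$ be a prime. (I) Let $k\ge 1$ be an integer with $2k\le p-3$, and put $t=p-1-2k$. Then each of the following five congruences holds modulo $p$; their right sides are combinations of $3,5,9,16,24$ sums respectively, with the indicated costs. (3 sums, cost $\tfrac{3p}{16}$) $$(-1)^k4^{2k-1}E_t\equiv 4^tS_t(0,\tfrac{1}{16}) + 2^tS_t(\tfrac{3}{8},\tfrac{7}{16}) + (2^t+4^t)S_t(\tfrac{7}{16},\tfrac{1}{2}).$$ (5 sums, cost $\tfrac{9p}{64}$) $$(-1)^k4^{2k-1}E_t\equiv 16^tS_t(0,\tfrac{1}{64}) + 2^tS_t(\tfrac{3}{8},\tfrac{7}{16}) + (2^t+4^t)S_t(\tfrac{7}{16},\tfrac{15}{32})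 + (2^t+4^t+8^t)S_t(\tfrac{15}{32},\tfrac{31}{64}) + (2^t+4^t+8^t+16^t)S_t(\tfrac{31}{64},\tfrac{1}{2}).$$ (9 sums, cost $\tfrac{43p}{384}$) $$(-1)^k4^{2k-1}E_t\equiv 32^tS_t(0,\tfrac{1}{128}) + 6^tS_t(\tfrac{1}{8},\tfrac{7}{48}) + 6^tS_t(\tfrac{3}{16},\tfrac{5}{24}) + (2^t+4^t)S_t(\tfrac{7}{16},\tfrac{11}{24}) + (2^t+4^t+6^t)S_t(\tfrac{11}{24},\tfrac{15}{32}) + (2^t+4^t+6^t+8^t)S_t(\tfrac{15}{32},\tfrac{23}{48}) + (2^t+4^t+8^t)S_t(\tfrac{23}{48},\tfrac{31}{64}) + (2^t+4^t+8^t+16^t)S_t(\tfrac{31}{64},\tfrac{63}{128}) + (2^t+4^t+8^t+16^t+32^t)S_t(\tfrac{63}{128},\tfrac{1}{2}).$$ (16 sums, cost $\tfrac{205p}{2304}$) $$(-1)^k4^{2k-1}E_t\equiv 64^tS_t(0,\tfrac{1}{256}) + (12^t+18^t)S_t(\tfrac{1}{16},\tfrac{5}{72}) + 12^tS_t(\tfrac{5}{72},\tfrac{7}{96})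 + (6^t+12^t)S_t(\tfrac{7}{48},\tfrac{11}{72}) + (6^t+12^t)S_t(\tfrac{13}{72},\tfrac{3}{16}) + (4^t+8^t+12^t)S_t(\tfrac{11}{48},\tfrac{15}{64}) + 18^tS_t(\tfrac{19}{72},\tfrac{17}{64}) + (4^t+8^t+12^t+18^t)S_t(\tfrac{17}{64},\tfrac{13}{48}) + 18^tS_t(\tfrac{19}{48},\tfrac{29}{72}) + 12^tS_t(\tfrac{41}{96},\tfrac{7}{16}) + (2^t+4^t+6^t+8^t)S_t(\tfrac{15}{32},\tfrac{23}{48}) + (2^t+4^t+6^t+8^t+12^t)S_t(\tfrac{23}{48},\tfrac{31}{64}) + (2^t+4^t+6^t+8^t+12^t+16^t)S_t(\tfrac{31}{64},\tfrac{35}{72}) + (2^t+4^t+8^t+16^t)S_t(\tfrac{35}{72},\tfrac{63}{128}) + (2^t+4^t+8^t+16^t+32^t)S_t(\tfrac{63}{128},\tfrac{127}{256}) + (2^t+4^t+8^t+16^t+32^t+64^t)S_t(\tfrac{127}{256},\tfrac{1}{2}).$$ (24 sums, cost $\tfrac{115p}{1536}$) $$(-1)^k4^{2k-1}E_t\equiv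 128^tS_t(0,\tfrac{1}{512}) + (48^t+72^t)S_t(\tfrac{1}{64},\tfrac{5}{288}) + 12^tS_t(\tfrac{5}{72},\tfrac{41}{576}) + (12^t+72^t)S_t(\tfrac{41}{576},\tfrac{7}{96}) + (6^t+12^t)S_t(\tfrac{7}{48},\tfrac{11}{72}) + (6^t+12^t)S_t(\tfrac{13}{72},\tfrac{3}{16}) + 36^tS_t(\tfrac{3}{16},\tfrac{55}{288}) + (4^t+8^t+12^t)S_t(\tfrac{11}{48},\tfrac{67}{288}) + (4^t+8^t+12^t+48^t+72^t)S_t(\tfrac{67}{288},\tfrac{15}{64}) + (4^t+8^t+12^t+16^t)S_t(\tfrac{15}{64},\tfrac{137}{576}) + (4^t+8^t+12^t+16^t)S_t(\tfrac{151}{576},\tfrac{19}{72}) + (4^t+8^t+12^t+16^t+18^t)S_t(\tfrac{19}{72},\tfrac{17}{64}) + (4^t+8^t+12^t+18^t+48^t+72^t)S_t(\tfrac{17}{64},\tfrac{77}{288}) + (4^t+8^t+12^t+18^t)S_t(\tfrac{77}{288},\tfrac{13}{48}) + 18^tS_t(\tfrac{19}{48},\tfrac{29}{72}) + 72^tS_t(\tfrac{41}{96},\tfrac{247}{576})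 + (2^t+4^t+6^t+8^t+36^t)S_t(\tfrac{137}{288},\tfrac{23}{48}) + (2^t+4^t+6^t+8^t+12^t)S_t(\tfrac{23}{48},\tfrac{139}{288}) + (2^t+4^t+6^t+8^t+12^t+48^t+72^t)S_t(\tfrac{139}{288},\tfrac{31}{64}) + (2^t+4^t+6^t+8^t+12^t+16^t)S_t(\tfrac{31}{64},\tfrac{35}{72}) + (2^t+4^t+8^t+16^t)S_t(\tfrac{35}{72},\tfrac{63}{128}) + (2^t+4^t+8^t+16^t+32^t)S_t(\tfrac{63}{128},\tfrac{127}{256}) + (2^t+4^t+8^t+16^t+32^t+64^t)S_t(\tfrac{127}{256},\tfrac{255}{512}) + (2^t+4^t+8^t+16^t+32^t+64^t+128^t)S_t(\tfrac{255}{512},\tfrac{1}{2}).$$ (II) Write $S(x,y)=S_{-2}(x,y)$, where $s^{-2}$ is taken modulo $p$. Then the following five congruences hold modulo $p$. $$-64\,E_{p-3}\equiv S(0,\tfrac{1}{16}) + 4S(\tfrac{3}{8},\tfrac{7}{16}) + 5S(\tfrac{7}{16},\tfrac{1}{2}).$$ $$-1024\,E_{p-3}\equiv S(0,\tfrac{1}{64})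 + 64S(\tfrac{3}{8},\tfrac{7}{16}) + 80S(\tfrac{7}{16},\tfrac{15}{32}) + 84S(\tfrac{15}{32},\tfrac{31}{64}) + 85S(\tfrac{31}{64},\tfrac{1}{2}).$$ $$-36864\,E_{p-3}\equiv 9S(0,\tfrac{1}{128}) + 256S(\tfrac{1}{8},\tfrac{7}{48}) + 256S(\tfrac{3}{16},\tfrac{5}{24}) + 2880S(\tfrac{7}{16},\tfrac{11}{24}) + 3136S(\tfrac{11}{24},\tfrac{15}{32}) + 3280S(\tfrac{15}{32},\tfrac{23}{48}) + 3024S(\tfrac{23}{48},\tfrac{31}{64}) + 3060S(\tfrac{31}{64},\tfrac{63}{128}) + 3069S(\tfrac{63}{128},\tfrac{1}{2}).$$ $$-1327104\,E_{p-3}\equiv 81S(0,\tfrac{1}{256}) + 3328S(\tfrac{1}{16},\tfrac{5}{72}) + 2304S(\tfrac{5}{72},\tfrac{7}{96}) + 11520S(\tfrac{7}{48},\tfrac{11}{72}) + 11520S(\tfrac{13}{72},\tfrac{3}{16}) + 28224S(\tfrac{11}{48},\tfrac{15}{64}) + 1024S(\tfrac{19}{72},\tfrac{17}{64}) + 29248S(\tfrac{17}{64},\tfrac{13}{48})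 + 1024S(\tfrac{19}{48},\tfrac{29}{72}) + 2304S(\tfrac{41}{96},\tfrac{7}{16}) + 118080S(\tfrac{15}{32},\tfrac{23}{48}) + 120384S(\tfrac{23}{48},\tfrac{31}{64}) + 121680S(\tfrac{31}{64},\tfrac{35}{72}) + 110160S(\tfrac{35}{72},\tfrac{63}{128}) + 110484S(\tfrac{63}{128},\tfrac{127}{256}) + 110565S(\tfrac{127}{256},\tfrac{1}{2}).$$ $$-5308416\,E_{p-3}\equiv 81S(0,\tfrac{1}{512}) + 832S(\tfrac{1}{64},\tfrac{5}{288}) + 9216S(\tfrac{5}{72},\tfrac{41}{576}) + 9472S(\tfrac{41}{576},\tfrac{7}{96}) + 46080S(\tfrac{7}{48},\tfrac{11}{72}) + 46080S(\tfrac{13}{72},\tfrac{3}{16}) + 1024S(\tfrac{3}{16},\tfrac{55}{288}) + 112896S(\tfrac{11}{48},\tfrac{67}{288}) + 113728S(\tfrac{67}{288},\tfrac{15}{64}) + 118080S(\tfrac{15}{64},\tfrac{137}{576}) + 118080S(\tfrac{151}{576},\tfrac{19}{72}) + 122176S(\tfrac{19}{72},\tfrac{17}{64}) + 117824S(\tfrac{17}{64},\tfrac{77}{288})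 + 116992S(\tfrac{77}{288},\tfrac{13}{48}) + 4096S(\tfrac{19}{48},\tfrac{29}{72}) + 256S(\tfrac{41}{96},\tfrac{247}{576}) + 473344S(\tfrac{137}{288},\tfrac{23}{48}) + 481536S(\tfrac{23}{48},\tfrac{139}{288}) + 482368S(\tfrac{139}{288},\tfrac{31}{64}) + 486720S(\tfrac{31}{64},\tfrac{35}{72}) + 440640S(\tfrac{35}{72},\tfrac{63}{128}) + 441936S(\tfrac{63}{128},\tfrac{127}{256}) + 442260S(\tfrac{127}{256},\tfrac{255}{512}) + 442341S(\tfrac{255}{512},\tfrac{1}{2}).$$ -/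

import Mathlib

/-- The power series of `sec z`, the inverse of the power series of `cos z`. -/
noncomputable def secSeries : PowerSeries ℚ := (PowerSeries.cos ℚ)⁻¹

/-- The coefficients `E_k` of `sec z = ∑ E_k z ^ k / k!`, as rational numbers. -/
noncomputable def eulerRat (k : ℕ) : ℚ := (k.factorial : ℚ) * PowerSeries.coeff k secSeries

theorem secSeries_mul_cos : secSeries * PowerSeries.cos ℚ = 1 := by
  unfold secSeries
  apply PowerSeries.inv_mul_cancel
  rw [← PowerSeries.coeff_zero_eq_constantCoeff_apply]
  simp [PowerSeries.cos]

/-- The coefficients of `sec z` are integers, so that `eulerNumber` below is well defined. -/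
theorem exists_int_eq_eulerRat (n : ℕ) : ∃ a : ℤ, (a : ℚ) = eulerRat n := by
  induction n using Nat.strong_induction_on with
  | _ n ih =>
    have h := congrArg (PowerSeries.coeff n) secSeries_mul_cos
    rw [PowerSeries.coeff_mul, Finset.Nat.sum_antidiagonal_eq_sum_range_succ_mk,
      Finset.sum_range_succ] at h
    have h0 : PowerSeries.coeff (n - n) (PowerSeries.cos ℚ) = 1 := by simp [PowerSeries.cos]
    simp only [h0, mul_one] at h
    have hn : eulerRat n = (n.factorial : ℚ) * PowerSeries.coeff n (1 : PowerSeries ℚ)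
        - ∑ j ∈ Finset.range n, (n.factorial : ℚ) *
          (PowerSeries.coeff j secSeries * PowerSeries.coeff (n - j) (PowerSeries.cos ℚ)) := by
      rw [← h, mul_add, Finset.mul_sum, eulerRat]
      ring
    rw [hn]
    have key : ∀ x : ℚ, (∃ a : ℤ, (a : ℚ) = x) ↔ x ∈ (Int.castRingHom ℚ).range := by
      intro x
      simp [RingHom.mem_range]
    rw [key]
    refine Subring.sub_mem _ ?_ (Subring.sum_mem _ ?_)
    · rw [PowerSeries.coeff_one, ← key]
      split_ifs
      · exact ⟨n.factorial, by simp⟩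
      · exact ⟨0, by simp⟩
    · intro j hj
      have hjn : j < n := Finset.mem_range.mp hj
      obtain ⟨a, ha⟩ := ih j hjn
      have hf : (n.factorial : ℚ) = n.choose j * j.factorial * (n - j).factorial := by
        exact_mod_cast (Nat.choose_mul_factorial_mul_factorial hjn.le).symm
      have hpos : ((n - j).factorial : ℚ) ≠ 0 := by exact_mod_cast (n - j).factorial_ne_zero
      rw [← key]
      refine ⟨n.choose j * a * (if Even (n - j) then (-1) ^ ((n - j) / 2) else 0), ?_⟩
      push_cast
      rw [ha, hf, eulerRat, PowerSeries.cos, PowerSeries.coeff_mk]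
      split_ifs
      · simp
        field_simp
      · simp

/-- The Euler number `E_k`, with `sec z = ∑ E_k z ^ k / k!` (so `E_0, E_2, E_4, E_6` are
`1, 1, 5, 61`). -/
noncomputable def eulerNumber (k : ℕ) : ℤ := (exists_int_eq_eulerRat k).choose

theorem eulerNumber_cast (k : ℕ) : (eulerNumber k : ℚ) = eulerRat k :=
  (exists_int_eq_eulerRat k).choose_spec

/-- The interval power sum `S_ℓ(x, y)`: the sum of `s ^ ℓ` over the integers `s` with
`x p < s < y p`, taken modulo the prime `p`; the exponent may be negative. -/
noncomputable def intervalPowerSum (p : ℕ) [Fact p.Prime] (l : ℤ) (x y : ℝ) : ZMod p :=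
  ∑ s ∈ Finset.Ioo ⌊x * p⌋ ⌈y * p⌉, (s : ZMod p) ^ l

theorem mem_intervalPowerSum_range (p : ℕ) (x y : ℝ) (s : ℤ) :
    s ∈ Finset.Ioo ⌊x * p⌋ ⌈y * p⌉ ↔ x * p < s ∧ (s : ℝ) < y * p := by
  rw [Finset.mem_Ioo, Int.floor_lt, Int.lt_ceil]

/-- A term `coeff * S(lo, hi)` of a linear combination of interval power sums. -/
structure IntervalTerm where
  coeff : ℤ
  lo : ℝ
  hi : ℝ

/-- The value modulo `p` of the linear combination `∑ c_i S_ℓ(x_i, y_i)`. -/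
noncomputable def combinationValue (p : ℕ) [Fact p.Prime] (l : ℤ) (L : List IntervalTerm) :
    ZMod p :=
  (L.map fun T => (T.coeff : ZMod p) * intervalPowerSum p l T.lo T.hi).sum

/-- The cost `p ∑ (y_i - x_i)` of the linear combination `∑ c_i S_ℓ(x_i, y_i)`. -/
noncomputable def combinationCost (p : ℕ) (L : List IntervalTerm) : ℝ :=
  p * (L.map fun T => T.hi - T.lo).sum

/-- The 3-term combination of sums `S_t(x, y)` with coefficients depending on `t`. -/
noncomputable def eulerComb3 (t : ℕ) : List IntervalTerm :=
  [⟨4 ^ t, 0, 1/16⟩,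
   ⟨2 ^ t, 3/8, 7/16⟩,
   ⟨2 ^ t + 4 ^ t, 7/16, 1/2⟩]

/-- The 5-term combination of sums `S_t(x, y)` with coefficients depending on `t`. -/
noncomputable def eulerComb5 (t : ℕ) : List IntervalTerm :=
  [⟨16 ^ t, 0, 1/64⟩,
   ⟨2 ^ t, 3/8, 7/16⟩,
   ⟨2 ^ t + 4 ^ t, 7/16, 15/32⟩,
   ⟨2 ^ t + 4 ^ t + 8 ^ t, 15/32, 31/64⟩,
   ⟨2 ^ t + 4 ^ t + 8 ^ t + 16 ^ t, 31/64, 1/2⟩]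

/-- The 9-term combination of sums `S_t(x, y)` with coefficients depending on `t`. -/
noncomputable def eulerComb9 (t : ℕ) : List IntervalTerm :=
  [⟨32 ^ t, 0, 1/128⟩,
   ⟨6 ^ t, 1/8, 7/48⟩,
   ⟨6 ^ t, 3/16, 5/24⟩,
   ⟨2 ^ t + 4 ^ t, 7/16, 11/24⟩,
   ⟨2 ^ t + 4 ^ t + 6 ^ t, 11/24, 15/32⟩,
   ⟨2 ^ t + 4 ^ t + 6 ^ t + 8 ^ t, 15/32, 23/48⟩,
   ⟨2 ^ t + 4 ^ t + 8 ^ t, 23/48, 31/64⟩,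
   ⟨2 ^ t + 4 ^ t + 8 ^ t + 16 ^ t, 31/64, 63/128⟩,
   ⟨2 ^ t + 4 ^ t + 8 ^ t + 16 ^ t + 32 ^ t, 63/128, 1/2⟩]

/-- The 16-term combination of sums `S_t(x, y)` with coefficients depending on `t`. -/
noncomputable def eulerComb16 (t : ℕ) : List IntervalTerm :=
  [⟨64 ^ t, 0, 1/256⟩,
   ⟨12 ^ t + 18 ^ t, 1/16, 5/72⟩,
   ⟨12 ^ t, 5/72, 7/96⟩,
   ⟨6 ^ t + 12 ^ t, 7/48, 11/72⟩,
   ⟨6 ^ t + 12 ^ t, 13/72, 3/16⟩,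
   ⟨4 ^ t + 8 ^ t + 12 ^ t, 11/48, 15/64⟩,
   ⟨18 ^ t, 19/72, 17/64⟩,
   ⟨4 ^ t + 8 ^ t + 12 ^ t + 18 ^ t, 17/64, 13/48⟩,
   ⟨18 ^ t, 19/48, 29/72⟩,
   ⟨12 ^ t, 41/96, 7/16⟩,
   ⟨2 ^ t + 4 ^ t + 6 ^ t + 8 ^ t, 15/32, 23/48⟩,
   ⟨2 ^ t + 4 ^ t + 6 ^ t + 8 ^ t + 12 ^ t, 23/48, 31/64⟩,
   ⟨2 ^ t + 4 ^ t + 6 ^ t + 8 ^ t + 12 ^ t + 16 ^ t, 31/64, 35/72⟩,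
   ⟨2 ^ t + 4 ^ t + 8 ^ t + 16 ^ t, 35/72, 63/128⟩,
   ⟨2 ^ t + 4 ^ t + 8 ^ t + 16 ^ t + 32 ^ t, 63/128, 127/256⟩,
   ⟨2 ^ t + 4 ^ t + 8 ^ t + 16 ^ t + 32 ^ t + 64 ^ t, 127/256, 1/2⟩]

/-- The 24-term combination of sums `S_t(x, y)` with coefficients depending on `t`. -/
noncomputable def eulerComb24 (t : ℕ) : List IntervalTerm :=
  [⟨128 ^ t, 0, 1/512⟩,
   ⟨48 ^ t + 72 ^ t, 1/64, 5/288⟩,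
   ⟨12 ^ t, 5/72, 41/576⟩,
   ⟨12 ^ t + 72 ^ t, 41/576, 7/96⟩,
   ⟨6 ^ t + 12 ^ t, 7/48, 11/72⟩,
   ⟨6 ^ t + 12 ^ t, 13/72, 3/16⟩,
   ⟨36 ^ t, 3/16, 55/288⟩,
   ⟨4 ^ t + 8 ^ t + 12 ^ t, 11/48, 67/288⟩,
   ⟨4 ^ t + 8 ^ t + 12 ^ t + 48 ^ t + 72 ^ t, 67/288, 15/64⟩,
   ⟨4 ^ t + 8 ^ t + 12 ^ t + 16 ^ t, 15/64, 137/576⟩,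
   ⟨4 ^ t + 8 ^ t + 12 ^ t + 16 ^ t, 151/576, 19/72⟩,
   ⟨4 ^ t + 8 ^ t + 12 ^ t + 16 ^ t + 18 ^ t, 19/72, 17/64⟩,
   ⟨4 ^ t + 8 ^ t + 12 ^ t + 18 ^ t + 48 ^ t + 72 ^ t, 17/64, 77/288⟩,
   ⟨4 ^ t + 8 ^ t + 12 ^ t + 18 ^ t, 77/288, 13/48⟩,
   ⟨18 ^ t, 19/48, 29/72⟩,
   ⟨72 ^ t, 41/96, 247/576⟩,
   ⟨2 ^ t + 4 ^ t + 6 ^ t + 8 ^ t + 36 ^ t, 137/288, 23/48⟩,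
   ⟨2 ^ t + 4 ^ t + 6 ^ t + 8 ^ t + 12 ^ t, 23/48, 139/288⟩,
   ⟨2 ^ t + 4 ^ t + 6 ^ t + 8 ^ t + 12 ^ t + 48 ^ t + 72 ^ t, 139/288, 31/64⟩,
   ⟨2 ^ t + 4 ^ t + 6 ^ t + 8 ^ t + 12 ^ t + 16 ^ t, 31/64, 35/72⟩,
   ⟨2 ^ t + 4 ^ t + 8 ^ t + 16 ^ t, 35/72, 63/128⟩,
   ⟨2 ^ t + 4 ^ t + 8 ^ t + 16 ^ t + 32 ^ t, 63/128, 127/256⟩,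
   ⟨2 ^ t + 4 ^ t + 8 ^ t + 16 ^ t + 32 ^ t + 64 ^ t, 127/256, 255/512⟩,
   ⟨2 ^ t + 4 ^ t + 8 ^ t + 16 ^ t + 32 ^ t + 64 ^ t + 128 ^ t, 255/512, 1/2⟩]

/-- The 3-term combination of sums `S_{-2}(x, y)` with integer coefficients. -/
noncomputable def vandiverComb3 : List IntervalTerm :=
  [⟨1, 0, 1/16⟩,
   ⟨4, 3/8, 7/16⟩,
   ⟨5, 7/16, 1/2⟩]

/-- The 5-term combination of sums `S_{-2}(x, y)` with integer coefficients. -/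
noncomputable def vandiverComb5 : List IntervalTerm :=
  [⟨1, 0, 1/64⟩,
   ⟨64, 3/8, 7/16⟩,
   ⟨80, 7/16, 15/32⟩,
   ⟨84, 15/32, 31/64⟩,
   ⟨85, 31/64, 1/2⟩]

/-- The 9-term combination of sums `S_{-2}(x, y)` with integer coefficients. -/
noncomputable def vandiverComb9 : List IntervalTerm :=
  [⟨9, 0, 1/128⟩,
   ⟨256, 1/8, 7/48⟩,
   ⟨256, 3/16, 5/24⟩,
   ⟨2880, 7/16, 11/24⟩,
   ⟨3136, 11/24, 15/32⟩,
   ⟨3280, 15/32, 23/48⟩,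
   ⟨3024, 23/48, 31/64⟩,
   ⟨3060, 31/64, 63/128⟩,
   ⟨3069, 63/128, 1/2⟩]

/-- The 16-term combination of sums `S_{-2}(x, y)` with integer coefficients. -/
noncomputable def vandiverComb16 : List IntervalTerm :=
  [⟨81, 0, 1/256⟩,
   ⟨3328, 1/16, 5/72⟩,
   ⟨2304, 5/72, 7/96⟩,
   ⟨11520, 7/48, 11/72⟩,
   ⟨11520, 13/72, 3/16⟩,
   ⟨28224, 11/48, 15/64⟩,
   ⟨1024, 19/72, 17/64⟩,
   ⟨29248, 17/64, 13/48⟩,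
   ⟨1024, 19/48, 29/72⟩,
   ⟨2304, 41/96, 7/16⟩,
   ⟨118080, 15/32, 23/48⟩,
   ⟨120384, 23/48, 31/64⟩,
   ⟨121680, 31/64, 35/72⟩,
   ⟨110160, 35/72, 63/128⟩,
   ⟨110484, 63/128, 127/256⟩,
   ⟨110565, 127/256, 1/2⟩]

/-- The 24-term combination of sums `S_{-2}(x, y)` with integer coefficients. -/
noncomputable def vandiverComb24 : List IntervalTerm :=
  [⟨81, 0, 1/512⟩,
   ⟨832, 1/64, 5/288⟩,
   ⟨9216, 5/72, 41/576⟩,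
   ⟨9472, 41/576, 7/96⟩,
   ⟨46080, 7/48, 11/72⟩,
   ⟨46080, 13/72, 3/16⟩,
   ⟨1024, 3/16, 55/288⟩,
   ⟨112896, 11/48, 67/288⟩,
   ⟨113728, 67/288, 15/64⟩,
   ⟨118080, 15/64, 137/576⟩,
   ⟨118080, 151/576, 19/72⟩,
   ⟨122176, 19/72, 17/64⟩,
   ⟨117824, 17/64, 77/288⟩,
   ⟨116992, 77/288, 13/48⟩,
   ⟨4096, 19/48, 29/72⟩,
   ⟨256, 41/96, 247/576⟩,
   ⟨473344, 137/288, 23/48⟩,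
   ⟨481536, 23/48, 139/288⟩,
   ⟨482368, 139/288, 31/64⟩,
   ⟨486720, 31/64, 35/72⟩,
   ⟨440640, 35/72, 63/128⟩,
   ⟨441936, 63/128, 127/256⟩,
   ⟨442260, 127/256, 255/512⟩,
   ⟨442341, 255/512, 1/2⟩]

/-! Every right side is a rewriting of the single sum `S_t(0, 1/4)`, and the Euler number is tied to
that sum once and for all. The numbers `(-1) ^ (n / 2) * E_n` are the coefficients of `sech`, so the
linear functional sending `X ^ n` to them satisfies `L(f(X + 1)) + L(f(X - 1)) = 2 f(0)`. Its Appell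
polynomials `A_t` therefore obey `A_t(x + 1) + A_t(x - 1) = 2 x ^ t`. Telescoping from `-p` to `p`,
where both ends are `0` modulo `p = 2m + 1`, expresses `A_t(0)` through the alternating sum of `j ^
t` for `1 ≤ j ≤ m`. The plain sum over that range vanishes for even `0 < t < p - 1`, so only the
even `j` count, and they give `S_t(0, 1/4)` (`signedEuler_eq_gridIntervalSum`). Sorting `s` by its
residue modulo 2 or 3, and using `s ^ t = (-s) ^ t`, gives for `g(x) = S_t(0, x)` the relations
`g(2x) = 2 ^ t (g(x) - g(1/2 - x))` and `g(3x) = 3 ^ t (g(x) + g(1/3 + x) - g(1/3 - x))`. All end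
points lie on the grid of mesh `1 / 4608`, with `4608 = 2 ^ 9 * 3 ^ 2`, so the five identities
become explicit linear combinations of these relations (`IsWeightedPrimitive`). Cost is saved when
an image of an interval falls on intervals already present. The first half of the theorem uses
weights `m ^ t`; the second takes `t = p - 3`, where `s ^ t = s ^ (-2)`, and clears denominators
with weights `Q / m ^ 2`. -/

open Finset Polynomial

/-! ### Euler numbers: recurrence, umbral functional and Appell polynomials. -/

/-- The sign-twisted Euler numbers `(-1) ^ (n / 2) * E_n`, the coefficients of `sech`. -/
noncomputable def signedEuler (R : Type*) [CommRing R] (n : ℕ) : R :=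
  (-1) ^ (n / 2) * (eulerNumber n : R)

/-- This is the coefficient of `z ^ n` in `sec z * cos z = 1`, multiplied by `n!`. -/
theorem sum_choose_mul_eulerNumber (n : ℕ) :
    ∑ i ∈ range (n + 1), (n.choose i : ℤ) * eulerNumber i *
      (if Even (n - i) then (-1) ^ ((n - i) / 2) else 0) = if n = 0 then 1 else 0 := by
  have h := congrArg (PowerSeries.coeff n) secSeries_mul_cos
  rw [PowerSeries.coeff_mul, Finset.Nat.sum_antidiagonal_eq_sum_range_succ_mk,
    PowerSeries.coeff_one] at h
  have h2 := congrArg (fun x : ℚ => (n.factorial : ℚ) * x) h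
  simp only [mul_sum] at h2
  have hr : (n.factorial : ℚ) * (if n = 0 then 1 else 0) = if n = 0 then 1 else 0 := by
    split_ifs with h0 <;> simp [h0]
  rw [hr] at h2
  have : (((∑ i ∈ range (n + 1), (n.choose i : ℤ) * eulerNumber i *
      (if Even (n - i) then (-1) ^ ((n - i) / 2) else 0) : ℤ)) : ℚ) =
      ((if n = 0 then 1 else 0 : ℤ) : ℚ) := by
    push_cast
    rw [← h2]
    refine sum_congr rfl fun i hi => ?_
    have hin : i ≤ n := Nat.lt_succ_iff.mp (mem_range.mp hi)
    have hf : (n.factorial : ℚ) = n.choose i * i.factorial * (n - i).factorial := by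
      exact_mod_cast (Nat.choose_mul_factorial_mul_factorial hin).symm
    have hpos : ((n - i).factorial : ℚ) ≠ 0 := by exact_mod_cast (n - i).factorial_ne_zero
    rw [eulerNumber_cast, hf, eulerRat, PowerSeries.cos, PowerSeries.coeff_mk]
    split_ifs
    · simp
      field_simp
    · simp
  exact_mod_cast this

/-- The hyperbolic form `sech z * (e ^ z + e ^ (-z)) = 2`. When `n - i` is even the signs of `E_i`
and of the cosine coefficient combine to `(-1) ^ (n / 2)`; the factor `1 + (-1) ^ (n - i)` kills the
other terms. -/
theorem sum_choose_mul_signedEuler (R : Type*) [CommRing R] (n : ℕ) :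
    ∑ i ∈ range (n + 1), (n.choose i : R) * signedEuler R i * (1 + (-1) ^ (n - i)) =
      if n = 0 then 2 else 0 := by
  have h := congrArg (fun z : ℤ => 2 * (-1) ^ (n / 2) * (z : R)) (sum_choose_mul_eulerNumber n)
  simp only [Int.cast_sum, mul_sum] at h
  have hr : 2 * (-1) ^ (n / 2) * (((if n = 0 then 1 else 0 : ℤ)) : R) =
      if n = 0 then 2 else 0 := by
    split_ifs with h0 <;> simp [h0]
  rw [hr] at h
  rw [← h]
  refine sum_congr rfl fun i hi => ?_
  have hin : i ≤ n := Nat.lt_succ_iff.mp (mem_range.mp hi)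
  unfold signedEuler
  rcases Nat.even_or_odd (n - i) with he | ho
  · have hdiv : n / 2 = i / 2 + (n - i) / 2 := by
      obtain ⟨m, hm⟩ := he
      omega
    have hsq : ((-1 : R) ^ ((n - i) / 2)) * (-1) ^ ((n - i) / 2) = 1 := by
      rw [← mul_pow]; simp
    rw [if_pos he, he.neg_one_pow, hdiv, pow_add]
    push_cast
    linear_combination (-2) * (-1) ^ (i / 2) * (n.choose i : R) * eulerNumber i * hsq
  · rw [if_neg (Nat.not_even_iff_odd.mpr ho), ho.neg_one_pow]
    simp

/-- The linear functional on polynomials sending `X ^ n` to the `n`-th signed Euler number. -/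
noncomputable def eulerFunctional (R : Type*) [CommRing R] : R[X] →ₗ[R] R :=
  Polynomial.lsum fun n => LinearMap.mul R R (signedEuler R n)

theorem eulerFunctional_X_pow (R : Type*) [CommRing R] (n : ℕ) :
    eulerFunctional R (X ^ n) = signedEuler R n := by
  rw [eulerFunctional, Polynomial.lsum_apply, ← Polynomial.monomial_one_right_eq_X_pow,
    Polynomial.sum_monomial_index] <;> simp

/-- By linearity only monomials matter, and for `X ^ n` the binomial theorem turns the claim into
`sum_choose_mul_signedEuler`. -/
theorem eulerFunctional_shift (R : Type*) [CommRing R] (f : R[X]) :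
    eulerFunctional R (f.comp (X + 1)) + eulerFunctional R (f.comp (X - 1)) = 2 * f.eval 0 := by
  induction f using Polynomial.induction_on' with
  | add f g hf hg =>
    simp only [add_comp, map_add, eval_add]
    linear_combination hf + hg
  | monomial n r =>
    rw [← C_mul_X_pow_eq_monomial]
    simp only [← smul_eq_C_mul, smul_comp, pow_comp, X_comp, eval_pow, eval_X, map_smul,
      smul_eq_mul, eval_smul]
    have h := sum_choose_mul_signedEuler R n
    have h1 : eulerFunctional R ((X + 1) ^ n) =
        ∑ i ∈ range (n + 1), (n.choose i : R) * signedEuler R i := by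
      rw [add_pow, map_sum]
      refine sum_congr rfl fun i _ => ?_
      rw [one_pow, mul_one, mul_comm, ← C_eq_natCast, ← smul_eq_C_mul, map_smul,
        eulerFunctional_X_pow, smul_eq_mul]
    have h2 : eulerFunctional R ((X - 1) ^ n) =
        ∑ i ∈ range (n + 1), (n.choose i : R) * signedEuler R i * (-1) ^ (n - i) := by
      rw [sub_eq_add_neg, add_pow, map_sum]
      refine sum_congr rfl fun i _ => ?_
      have : (X : R[X]) ^ i * (-1) ^ (n - i) * (n.choose i : R[X]) =
          ((n.choose i : R) * (-1) ^ (n - i)) • X ^ i := by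
        rw [smul_eq_C_mul]
        simp only [map_mul, map_pow, map_neg, map_one, map_natCast]
        ring
      rw [this, map_smul, eulerFunctional_X_pow, smul_eq_mul]
      ring
    simp only [mul_add, mul_one, sum_add_distrib] at h
    rw [h1, h2]
    by_cases hn : n = 0
    · subst hn
      simp at h ⊢
      linear_combination r * h
    · rw [if_neg hn] at h
      rw [zero_pow hn]
      linear_combination r * h

/-- The Appell polynomials of the signed Euler numbers, as functions. -/
noncomputable def eulerAppell (R : Type*) [CommRing R] (t : ℕ) (x : R) : R :=
  eulerFunctional R ((X + C x) ^ t)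

theorem eulerAppell_zero (R : Type*) [CommRing R] (t : ℕ) :
    eulerAppell R t 0 = signedEuler R t := by
  simp [eulerAppell, eulerFunctional_X_pow]

theorem eulerAppell_add_one_add (R : Type*) [CommRing R] (t : ℕ) (x : R) :
    eulerAppell R t (x + 1) + eulerAppell R t (x - 1) = 2 * x ^ t := by
  have h := eulerFunctional_shift R ((X + C x) ^ t)
  simp only [pow_comp, add_comp, X_comp, C_comp, eval_pow, eval_add, eval_X, eval_C,
    zero_add] at h
  rw [← h, eulerAppell, eulerAppell]
  congr 3 <;> simp only [map_add, map_sub, map_one] <;> ring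

/-- Alternating telescoping for the Appell polynomials, over a symmetric range. -/
theorem eulerAppell_telescope (R : Type*) [CommRing R] (t : ℕ) (ht : Even t) (m : ℕ) :
    eulerAppell R t (2 * m + 1) + eulerAppell R t (-(2 * m + 1)) =
      (-1) ^ m * (2 * 0 ^ t + 4 * 2 ^ t * ∑ j ∈ Icc 1 m, (-1) ^ j * (j : R) ^ t) := by
  induction m with
  | zero =>
    have h := eulerAppell_add_one_add R t 0
    simp at h ⊢
    linear_combination h
  | succ m ih =>
    -- The range grows at both ends: the functional equation at `2m + 2` and at `-(2m + 2)` has the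
    -- same right side because `t` is even.
    have h1 := eulerAppell_add_one_add R t (2 * m + 2)
    have h2 := eulerAppell_add_one_add R t (-(2 * m + 2))
    rw [ht.neg_pow] at h2
    have e1 : (2 * m + 2 - 1 : R) = 2 * m + 1 := by ring
    have e2 : (-(2 * m + 2) + 1 : R) = -(2 * m + 1) := by ring
    have e3 : (2 * m + 2 + 1 : R) = 2 * (m + 1) + 1 := by ring
    have e4 : (-(2 * m + 2) - 1 : R) = -(2 * (m + 1) + 1) := by ring
    have e5 : (2 * m + 2 : R) ^ t = 2 ^ t * (m + 1) ^ t := by rw [← mul_pow]; ring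
    have hsq : ((-1 : R) ^ m) * (-1) ^ m = 1 := by rw [← mul_pow]; simp
    rw [e1, e3] at h1
    rw [e2, e4] at h2
    rw [e5] at h1 h2
    rw [sum_Icc_succ_top (by omega)]
    push_cast
    rw [pow_succ]
    linear_combination h1 + h2 - ih - 4 * 2 ^ t * ((m : R) + 1) ^ t * hsq

/-! ### Power sums on a grid: additivity, halving and trisection. -/

/-- The sum of `s ^ t` modulo `p` over the `s < p` with `a / N < s / p < b / N`. -/
def gridIntervalSum (p t N a b : ℕ) : ZMod p :=
  ∑ s ∈ range p with a * p < s * N ∧ s * N < b * p, (s : ZMod p) ^ t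

theorem mul_ne_mul_of_coprime {p N a s : ℕ} (h : p.Coprime N) (ha : 0 < a) (haN : a < N) :
    s * N ≠ a * p := by
  intro e
  have h1 : N ∣ a := h.symm.dvd_of_dvd_mul_right (Dvd.intro_left s e)
  exact absurd (Nat.le_of_dvd ha h1) (by omega)

/-- Both inequalities are strict, so additivity requires that no integer sits at the common end
point `b p / N`; coprimality of `p` and `N` with `0 < b < N` ensures this. -/
theorem gridIntervalSum_add {p t N a b c : ℕ} (h : p.Coprime N) (hab : a ≤ b) (hbc : b ≤ c)
    (hc : c < N) (ha : 0 < b) :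
    gridIntervalSum p t N a b + gridIntervalSum p t N b c = gridIntervalSum p t N a c := by
  unfold gridIntervalSum
  rw [← sum_union]
  · refine sum_congr ?_ fun _ _ => rfl
    ext s
    have h1 := mul_ne_mul_of_coprime (s := s) h ha (lt_of_le_of_lt hbc hc)
    have h2 := Nat.mul_le_mul_right p hab
    have h3 := Nat.mul_le_mul_right p hbc
    simp only [mem_union, mem_filter, mem_range]
    omega
  · rw [disjoint_left]
    intro s
    simp only [mem_filter, mem_range]
    omega

theorem gridIntervalSum_self (p t N a : ℕ) : gridIntervalSum p t N a a = 0 := by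
  unfold gridIntervalSum
  rw [filter_false_of_mem, sum_empty]
  intro s _
  omega

/-- Halving: even `s` are doubles, and for odd `s` the difference `p - s` is a double. -/
theorem gridIntervalSum_two_mul {p t a b : ℕ} (hp : Odd p) (ht : Even t) :
    gridIntervalSum p t (2 * (a + b)) 0 (2 * a) =
      2 ^ t * (gridIntervalSum p t (2 * (a + b)) 0 a +
        gridIntervalSum p t (2 * (a + b)) b (a + b)) := by
  unfold gridIntervalSum
  rw [← sum_filter_add_sum_filter_not _ (fun s => s % 2 = 0),
    mul_add ((2 : ZMod p) ^ t), mul_sum, mul_sum]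
  have hp2 : p % 2 = 1 := Nat.odd_iff.mp hp
  congr 1
  · refine sum_nbij' (fun s => s / 2) (fun u => 2 * u) ?_ ?_ ?_ ?_ ?_
    · intro s hs
      simp only [mem_filter, mem_range] at hs ⊢
      have e : s * (2 * (a + b)) = 2 * (s / 2 * (2 * (a + b))) := by
        rw [← mul_assoc 2 (s / 2), Nat.mul_div_cancel' (Nat.dvd_of_mod_eq_zero hs.2)]
      have e2 : 2 * a * p = 2 * (a * p) := by ring
      omega
    · intro u hu
      simp only [mem_filter, mem_range] at hu ⊢
      have e : 2 * u * (2 * (a + b)) = 2 * (u * (2 * (a + b))) := by ring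
      have e2 : 2 * a * p = 2 * (a * p) := by ring
      have hlt : 2 * u < p := by
        by_contra hc
        have := Nat.mul_le_mul_right (a + b) (not_lt.mp hc)
        nlinarith
      omega
    · intro s hs
      simp only [mem_filter, mem_range] at hs
      omega
    · intro u _
      simp
    · intro s hs
      simp only [mem_filter, mem_range] at hs
      rw [← mul_pow]
      congr 1
      exact_mod_cast congrArg (Nat.cast (R := ZMod p))
        (Nat.mul_div_cancel' (Nat.dvd_of_mod_eq_zero hs.2)).symm
  -- Odd `s` are `p - 2v`, hence `-2v` modulo `p`. The bounds `0 < s < a p / (a + b)` become `b p /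
  -- N < v < p / 2` with `N = 2(a + b)`.
  · refine sum_nbij' (fun s => (p - s) / 2) (fun v => p - 2 * v) ?_ ?_ ?_ ?_ ?_
    · intro s hs
      simp only [mem_filter, mem_range] at hs ⊢
      obtain ⟨v, hv⟩ : ∃ v, p = s + 2 * v := ⟨(p - s) / 2, by omega⟩
      have hv2 : (p - s) / 2 = v := by omega
      rw [hv2]
      have e := congrArg (· * (a + b)) hv
      refine ⟨by omega, ?_, ?_⟩ <;> nlinarith
    · intro v hv
      simp only [mem_filter, mem_range] at hv ⊢
      have h1 : 2 * v < p := by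
        by_contra hc
        have := Nat.mul_le_mul_right (a + b) (not_lt.mp hc)
        nlinarith
      have h0 : 0 < v := by
        rcases Nat.eq_zero_or_pos v with h | h
        · subst h; omega
        · exact h
      obtain ⟨s, hs⟩ : ∃ s, p = s + 2 * v := ⟨p - 2 * v, by omega⟩
      have hs2 : p - 2 * v = s := by omega
      rw [hs2]
      have e := congrArg (· * (a + b)) hs
      refine ⟨⟨by omega, ?_, ?_⟩, by omega⟩
      · have : 0 < a + b := by
          by_contra hc
          have : a + b = 0 := by omega
          rw [this] at hv
          omega
        rw [zero_mul]
        exact Nat.mul_pos (by omega) (by omega)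
      · nlinarith
    · intro s hs
      simp only [mem_filter, mem_range] at hs
      omega
    · intro v hv
      simp only [mem_filter, mem_range] at hv
      have h1 : 2 * v < p := by
        by_contra hc
        have := Nat.mul_le_mul_right (a + b) (not_lt.mp hc)
        nlinarith
      omega
    · intro s hs
      simp only [mem_filter, mem_range] at hs
      obtain ⟨v, hv⟩ : ∃ v, p = s + 2 * v := ⟨(p - s) / 2, by omega⟩
      have hv2 : (p - s) / 2 = v := by omega
      rw [hv2, ← mul_pow, ← ht.neg_pow]
      congr 1
      have := congrArg (Nat.cast (R := ZMod p)) hv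
      push_cast [ZMod.natCast_self] at this
      linear_combination this

/-- Trisection according to the residue of `s` modulo `3`. -/
theorem gridIntervalSum_three_mul {p t a b : ℕ} (hp : ¬ 3 ∣ p) (ht : Even t) :
    gridIntervalSum p t (3 * (a + b)) 0 (3 * a) =
      3 ^ t * (gridIntervalSum p t (3 * (a + b)) 0 a +
        gridIntervalSum p t (3 * (a + b)) b (a + b) +
        gridIntervalSum p t (3 * (a + b)) (a + b) (2 * a + b)) := by
  unfold gridIntervalSum
  have hp3 : p % 3 ≠ 0 := fun h => hp (Nat.dvd_of_mod_eq_zero h)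
  -- Since `3 ∤ p`, the residues `0`, `p`, `-p` modulo 3 are distinct, and `s` is `3u`, `p - 3v` or
  -- `3v - p` accordingly. With `N = 3(a + b)`, these put `u / p` in `(0, a / N)`, `v / p` in `(b /
  -- N, 1/3)`, and `v / p` in `(1/3, (2a + b) / N)`.
  rw [← sum_filter_add_sum_filter_not _ (fun s => s % 3 = 0),
    ← sum_filter_add_sum_filter_not (filter (fun s => ¬ s % 3 = 0) _) (fun s => s % 3 = p % 3),
    mul_add ((3 : ZMod p) ^ t), mul_add ((3 : ZMod p) ^ t), mul_sum, mul_sum, mul_sum, add_assoc]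
  congr 1
  · refine sum_nbij' (fun s => s / 3) (fun u => 3 * u) ?_ ?_ ?_ ?_ ?_
    · intro s hs
      simp only [mem_filter, mem_range] at hs ⊢
      obtain ⟨v, hv⟩ : ∃ v, s = 3 * v := ⟨s / 3, by omega⟩
      have hv2 : s / 3 = v := by omega
      rw [hv2]
      have e := congrArg (· * (a + b)) hv
      refine ⟨by omega, ?_, ?_⟩ <;> nlinarith
    · intro u hu
      simp only [mem_filter, mem_range] at hu ⊢
      have hlt : 3 * u < p := by
        by_contra hc
        have := Nat.mul_le_mul_right (a + b) (not_lt.mp hc)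
        nlinarith
      refine ⟨⟨hlt, ?_, ?_⟩, by omega⟩ <;> nlinarith
    · intro s hs
      simp only [mem_filter, mem_range] at hs
      omega
    · intro u _
      simp
    · intro s hs
      simp only [mem_filter, mem_range] at hs
      rw [← mul_pow]
      congr 1
      exact_mod_cast congrArg (Nat.cast (R := ZMod p))
        (Nat.mul_div_cancel' (Nat.dvd_of_mod_eq_zero hs.2)).symm
  congr 1
  · refine sum_nbij' (fun s => (p - s) / 3) (fun v => p - 3 * v) ?_ ?_ ?_ ?_ ?_
    · intro s hs
      simp only [mem_filter, mem_range] at hs ⊢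
      obtain ⟨v, hv⟩ : ∃ v, p = s + 3 * v := ⟨(p - s) / 3, by omega⟩
      have hv2 : (p - s) / 3 = v := by omega
      rw [hv2]
      have e := congrArg (· * (a + b)) hv
      refine ⟨by omega, ?_, ?_⟩ <;> nlinarith
    · intro v hv
      simp only [mem_filter, mem_range] at hv ⊢
      have h1 : 3 * v < p := by
        by_contra hc
        have := Nat.mul_le_mul_right (a + b) (not_lt.mp hc)
        nlinarith
      have h0 : 0 < v := by
        rcases Nat.eq_zero_or_pos v with h | h
        · subst h; omega
        · exact h
      obtain ⟨s, hs⟩ : ∃ s, p = s + 3 * v := ⟨p - 3 * v, by omega⟩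
      have hs2 : p - 3 * v = s := by omega
      rw [hs2]
      have e := congrArg (· * (a + b)) hs
      refine ⟨⟨⟨by omega, ?_, ?_⟩, by omega⟩, by omega⟩
      · have : 0 < a + b := by
          by_contra hc
          have : a + b = 0 := by omega
          rw [this] at hv
          omega
        rw [zero_mul]
        exact Nat.mul_pos (by omega) (by omega)
      · nlinarith
    · intro s hs
      simp only [mem_filter, mem_range] at hs
      omega
    · intro v hv
      simp only [mem_filter, mem_range] at hv
      have h1 : 3 * v < p := by
        by_contra hc
        have := Nat.mul_le_mul_right (a + b) (not_lt.mp hc)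
        nlinarith
      omega
    · intro s hs
      simp only [mem_filter, mem_range] at hs
      obtain ⟨v, hv⟩ : ∃ v, p = s + 3 * v := ⟨(p - s) / 3, by omega⟩
      have hv2 : (p - s) / 3 = v := by omega
      rw [hv2, ← mul_pow, ← ht.neg_pow]
      congr 1
      have := congrArg (Nat.cast (R := ZMod p)) hv
      push_cast [ZMod.natCast_self] at this
      linear_combination this
  · refine sum_nbij' (fun s => (p + s) / 3) (fun v => 3 * v - p) ?_ ?_ ?_ ?_ ?_
    · intro s hs
      simp only [mem_filter, mem_range] at hs ⊢
      obtain ⟨v, hv⟩ : ∃ v, p + s = 3 * v := ⟨(p + s) / 3, by omega⟩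
      have hv2 : (p + s) / 3 = v := by omega
      rw [hv2]
      have e := congrArg (· * (a + b)) hv
      refine ⟨by omega, ?_, ?_⟩ <;> nlinarith
    · intro v hv
      simp only [mem_filter, mem_range] at hv ⊢
      have h1 : p < 3 * v := by
        by_contra hc
        have := Nat.mul_le_mul_right (a + b) (not_lt.mp hc)
        nlinarith
      obtain ⟨s, hs⟩ : ∃ s, p + s = 3 * v := ⟨3 * v - p, by omega⟩
      have hs2 : 3 * v - p = s := by omega
      rw [hs2]
      have e := congrArg (· * (a + b)) hs
      have h2 : s * (3 * (a + b)) < 3 * a * p := by nlinarith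
      refine ⟨⟨⟨?_, ?_, h2⟩, by omega⟩, by omega⟩
      · by_contra hc
        have := Nat.mul_le_mul_right (3 * (a + b)) (not_lt.mp hc)
        nlinarith
      · have : 0 < a + b := by
          by_contra hc
          have : a + b = 0 := by omega
          rw [this] at hv
          omega
        rw [zero_mul]
        exact Nat.mul_pos (by omega) (by omega)
    · intro s hs
      simp only [mem_filter, mem_range] at hs
      obtain ⟨v, hv⟩ : ∃ v, p + s = 3 * v := ⟨(p + s) / 3, by omega⟩
      have hv2 : (p + s) / 3 = v := by omega
      rw [hv2]
      omega
    · intro v hv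
      simp only [mem_filter, mem_range] at hv
      have h1 : p < 3 * v := by
        by_contra hc
        have := Nat.mul_le_mul_right (a + b) (not_lt.mp hc)
        nlinarith
      omega
    · intro s hs
      simp only [mem_filter, mem_range] at hs
      obtain ⟨v, hv⟩ : ∃ v, p + s = 3 * v := ⟨(p + s) / 3, by omega⟩
      have hv2 : (p + s) / 3 = v := by omega
      rw [hv2, ← mul_pow]
      congr 1
      have := congrArg (Nat.cast (R := ZMod p)) hv
      push_cast [ZMod.natCast_self] at this
      linear_combination this

/-! ### Sums over half and a quarter of the residues, and the Euler numbers. -/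

theorem sum_range_pow_eq_zero {p t : ℕ} [Fact p.Prime] (ht : t < p - 1) :
    ∑ s ∈ range p, (s : ZMod p) ^ t = 0 := by
  have h := FiniteField.sum_pow_lt_card_sub_one (ZMod p) t (by rwa [ZMod.card])
  rw [← h]
  refine sum_nbij' (fun s => (s : ZMod p)) (fun x => x.val) ?_ ?_ ?_ ?_ ?_
  · simp
  · intro x _
    exact mem_range.mpr (ZMod.val_lt x)
  · intro s hs
    exact ZMod.val_cast_of_lt (mem_range.mp hs)
  · intro x _
    exact ZMod.natCast_zmod_val x
  · simp

/-- The sum over the lower half of the residues vanishes for even `0 < t < p - 1`. -/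
theorem gridIntervalSum_half {p t M : ℕ} [Fact p.Prime] (hp : Odd p) (ht : Even t) (ht0 : t ≠ 0)
    (htp : t < p - 1) (hM : 0 < M) : gridIntervalSum p t (2 * M) 0 M = 0 := by
  have hp2 : p % 2 = 1 := Nat.odd_iff.mp hp
  have key : ∀ s, s * (2 * M) < M * p ↔ 2 * s < p := by
    intro s
    rw [show s * (2 * M) = M * (2 * s) by ring]
    exact Nat.mul_lt_mul_left hM
  have h := sum_range_pow_eq_zero (p := p) htp
  -- The reflection `s ↦ p - s` carries the upper half to the lower one and preserves `s ^ t`, so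
  -- the vanishing full sum is twice the lower half.
  rw [← sum_filter_add_sum_filter_not _ (fun s => 2 * s < p)] at h
  have h1 : ∑ s ∈ range p with 2 * s < p, (s : ZMod p) ^ t = gridIntervalSum p t (2 * M) 0 M := by
    unfold gridIntervalSum
    symm
    refine sum_subset ?_ ?_
    · intro s
      simp only [mem_filter, mem_range, key]
      tauto
    · intro s h1 h2
      simp only [mem_filter, mem_range, key] at h1 h2
      have : s = 0 := by
        by_contra hs
        exact h2 ⟨h1.1, by rw [zero_mul]; exact Nat.mul_pos (by omega) (by omega), h1.2⟩
      simp [this, ht0]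
  have h2 : ∑ s ∈ range p with ¬ 2 * s < p, (s : ZMod p) ^ t =
      gridIntervalSum p t (2 * M) 0 M := by
    unfold gridIntervalSum
    refine sum_nbij' (fun s => p - s) (fun s => p - s) ?_ ?_ ?_ ?_ ?_
    · intro s
      simp only [mem_filter, mem_range, key]
      intro hs
      refine ⟨by omega, ?_, by omega⟩
      rw [zero_mul]
      exact Nat.mul_pos (by omega) (by omega)
    · intro s
      simp only [mem_filter, mem_range, key]
      intro hs
      have : 0 < s := by
        rcases Nat.eq_zero_or_pos s with h | h
        · subst h; omega
        · exact h
      omega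
    · intro s hs
      simp only [mem_filter, mem_range] at hs
      omega
    · intro s hs
      simp only [mem_filter, mem_range] at hs
      omega
    · intro s hs
      simp only [mem_filter, mem_range] at hs
      rw [Nat.cast_sub hs.1.le, ZMod.natCast_self, zero_sub, ht.neg_pow]
  rw [h1, h2, ← two_mul] at h
  have h20 : (2 : ZMod p) ≠ 0 := by
    intro h0
    have := (ZMod.natCast_eq_zero_iff 2 p).mp (by exact_mod_cast h0)
    have := (Nat.prime_dvd_prime_iff_eq (Fact.out : p.Prime) Nat.prime_two).mp this
    omega
  exact (mul_eq_zero.mp h).resolve_left h20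

theorem ZMod.natCast_ne_zero_of_coprime {p n : ℕ} [Fact p.Prime] (h : p.Coprime n) :
    (n : ZMod p) ≠ 0 := by
  rw [Ne, ZMod.natCast_eq_zero_iff]
  exact (Nat.Prime.coprime_iff_not_dvd Fact.out).mp h

/-- The signed Euler numbers modulo `p` as sums over the lower quarter of the residues. -/
theorem signedEuler_eq_gridIntervalSum {p t M : ℕ} [Fact p.Prime] (hp : Odd p) (ht : Even t)
    (ht0 : t ≠ 0) (htp : t < p - 1) (hM : 0 < M) :
    signedEuler (ZMod p) t =
      (-1) ^ ((p - 1) / 2) * 4 * 4 ^ t * gridIntervalSum p t (4 * M) 0 M := by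
  obtain ⟨m, hm⟩ := hp
  have h2 : (2 : ZMod p) ≠ 0 := by
    have h : p.Coprime 2 := Nat.coprime_two_right.mpr ⟨m, hm⟩
    exact_mod_cast ZMod.natCast_ne_zero_of_coprime h
  have hm0 : (2 * m + 1 : ZMod p) = 0 := by
    have h := congrArg (Nat.cast (R := ZMod p)) hm
    push_cast [ZMod.natCast_self] at h
    exact h.symm
  -- As `2m + 1 = p`, both end points are `0`, and the left side becomes twice the signed Euler
  -- number.
  have htel := eulerAppell_telescope (ZMod p) t ht m
  rw [hm0, neg_zero, eulerAppell_zero, zero_pow ht0] at htel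
  have hhalf := gridIntervalSum_half (M := 2 * M) ⟨m, hm⟩ ht ht0 htp (by omega)
  have hall : ∑ j ∈ Icc 1 m, (j : ZMod p) ^ t = 0 := by
    rw [← hhalf, gridIntervalSum]
    refine sum_congr ?_ fun _ _ => rfl
    ext s
    have key : s * (2 * (2 * M)) < 2 * M * p ↔ 2 * s < p := by
      rw [show s * (2 * (2 * M)) = 2 * M * (2 * s) by ring]
      exact Nat.mul_lt_mul_left (by omega)
    have key0 : 0 * p < s * (2 * (2 * M)) ↔ 0 < s := by
      rw [zero_mul]
      exact Nat.mul_pos_iff_of_pos_right (by omega)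
    simp only [mem_filter, mem_range, mem_Icc, key, key0]
    omega
  have heven : ∑ j ∈ Icc 1 m with Even j, (j : ZMod p) ^ t =
      2 ^ t * gridIntervalSum p t (4 * M) 0 M := by
    have key : ∀ s, s * (4 * M) < M * p ↔ 4 * s < p := by
      intro s
      rw [show s * (4 * M) = M * (4 * s) by ring]
      exact Nat.mul_lt_mul_left hM
    have key0 : ∀ s, 0 * p < s * (4 * M) ↔ 0 < s := by
      intro s
      rw [zero_mul]
      exact Nat.mul_pos_iff_of_pos_right (by omega)
    rw [gridIntervalSum, mul_sum]
    refine sum_nbij' (fun s => s / 2) (fun u => 2 * u) ?_ ?_ ?_ ?_ ?_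
    · intro s
      simp only [mem_filter, mem_range, mem_Icc, key, key0, Nat.even_iff]
      omega
    · intro s
      simp only [mem_filter, mem_range, mem_Icc, key, key0, Nat.even_iff]
      omega
    · intro s
      simp only [mem_filter, Nat.even_iff]
      omega
    · intro s _
      simp
    · intro s hs
      simp only [mem_filter] at hs
      rw [← mul_pow]
      congr 1
      exact_mod_cast congrArg (Nat.cast (R := ZMod p)) (Nat.mul_div_cancel' hs.2.two_dvd).symm
  -- Adding the vanishing plain sum cancels the odd `j` and doubles the even ones.
  have halt : ∑ j ∈ Icc 1 m, (-1) ^ j * (j : ZMod p) ^ t =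
      2 * ∑ j ∈ Icc 1 m with Even j, (j : ZMod p) ^ t := by
    have h : ∑ j ∈ Icc 1 m, (-1) ^ j * (j : ZMod p) ^ t =
        ∑ j ∈ Icc 1 m, (-1) ^ j * (j : ZMod p) ^ t + ∑ j ∈ Icc 1 m, (j : ZMod p) ^ t := by
      rw [hall, add_zero]
    rw [h, ← sum_add_distrib, sum_filter, mul_sum]
    refine sum_congr rfl fun j _ => ?_
    split_ifs with hj
    · rw [hj.neg_one_pow]
      ring
    · rw [(Nat.not_even_iff_odd.mp hj).neg_one_pow]
      ring
  rw [halt, heven] at htel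
  have hmm : (p - 1) / 2 = m := by omega
  have h4 : (4 : ZMod p) ^ t = 2 ^ t * 2 ^ t := by rw [← mul_pow]; norm_num
  rw [hmm, h4]
  apply mul_left_cancel₀ h2
  linear_combination htel

/-- The constants come from `(p - 1) / 2 = t / 2 + k`, which leaves the sign `(-1) ^ k`, and from
Fermat in the form `4 ^ (2k - 1) * 4 * 4 ^ t = 4 ^ (p - 1) = 1`. -/
theorem eulerNumber_eq_gridIntervalSum {p t k M : ℕ} [Fact p.Prime] (hp : Odd p) (hk : 1 ≤ k)
    (ht : t + 2 * k = p - 1) (ht0 : t ≠ 0) (hM : 0 < M) :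
    (-1) ^ k * 4 ^ (2 * k - 1) * (eulerNumber t : ZMod p) =
      gridIntervalSum p t (4 * M) 0 M := by
  have hpar := Nat.odd_iff.mp hp
  have hte : Even t := Nat.even_iff.mpr (by omega)
  have h := signedEuler_eq_gridIntervalSum hp hte ht0 (by omega) hM
  have h4 : (4 : ZMod p) ^ (2 * k - 1) * 4 * 4 ^ t = 1 := by
    rw [← pow_succ, ← pow_add, show 2 * k - 1 + 1 + t = p - 1 by omega]
    apply ZMod.pow_card_sub_one_eq_one
    have : p.Coprime 4 := by
      rw [show 4 = 2 ^ 2 by norm_num]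
      exact (Nat.coprime_two_right.mpr hp).pow_right 2
    exact_mod_cast ZMod.natCast_ne_zero_of_coprime this
  have hm : (p - 1) / 2 = t / 2 + k := by omega
  rw [signedEuler, hm, pow_add] at h
  have hsq1 : ((-1 : ZMod p) ^ k) * (-1) ^ k = 1 := by rw [← mul_pow]; simp
  have hsq2 : ((-1 : ZMod p) ^ (t / 2)) * (-1) ^ (t / 2) = 1 := by rw [← mul_pow]; simp
  linear_combination (-1) ^ k * 4 ^ (2 * k - 1) * (-1) ^ (t / 2) * h
    - (-1) ^ k * 4 ^ (2 * k - 1) * (eulerNumber t : ZMod p) * hsq2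
    + (4 ^ (2 * k - 1) * 4 * 4 ^ t * gridIntervalSum p t (4 * M) 0 M *
      (-1) ^ k * (-1) ^ k) * hsq2
    + (4 ^ (2 * k - 1) * 4 * 4 ^ t * gridIntervalSum p t (4 * M) 0 M) * hsq1
    + gridIntervalSum p t (4 * M) 0 M * h4

/-! ### From real end points to grid points. -/

/-- Clearing the denominator `N` leaves inequalities between natural numbers: a lower end at least
`0` excludes negative `s`, and `b ≤ N` forces `s < p`. -/
theorem intervalPowerSum_eq_gridIntervalSum {p t N a b : ℕ} [Fact p.Prime] (hN : 0 < N)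
    (hb : b ≤ N) :
    intervalPowerSum p t (a / N) (b / N) = gridIntervalSum p t N a b := by
  have hp : 0 < p := (Fact.out : p.Prime).pos
  have hNR : (0 : ℝ) < N := by exact_mod_cast hN
  have key : ∀ s : ℕ, ((a : ℝ) / N * p < ((s : ℤ) : ℝ) ∧ ((s : ℤ) : ℝ) < (b : ℝ) / N * p) ↔
      (a * p < s * N ∧ s * N < b * p) := by
    intro s
    rw [div_mul_eq_mul_div, div_mul_eq_mul_div, div_lt_iff₀ hNR, lt_div_iff₀ hNR]
    norm_cast
  unfold intervalPowerSum gridIntervalSum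
  symm
  refine sum_nbij' (fun s => (s : ℤ)) (fun s => s.toNat) ?_ ?_ ?_ ?_ ?_
  · intro s hs
    rw [mem_intervalPowerSum_range, key]
    simp only [mem_filter] at hs
    exact hs.2
  · intro s hs
    rw [mem_intervalPowerSum_range] at hs
    have h0 : (0 : ℝ) < s := lt_of_le_of_lt (by positivity) hs.1
    obtain ⟨n, rfl⟩ := Int.eq_ofNat_of_zero_le (show 0 ≤ s by exact_mod_cast h0.le)
    have hn := (key n).mp hs
    rw [Int.toNat_natCast, mem_filter, mem_range]
    refine ⟨?_, hn⟩
    have := hn.2.trans_le (Nat.mul_le_mul_right p hb)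
    rw [mul_comm N p] at this
    exact Nat.lt_of_mul_lt_mul_right this
  · intro s _
    simp
  · intro s hs
    rw [mem_intervalPowerSum_range] at hs
    have h0 : (0 : ℝ) < s := lt_of_le_of_lt (by positivity) hs.1
    exact Int.toNat_of_nonneg (by exact_mod_cast h0.le)
  · intro s _
    simp

theorem gridIntervalSum_eq_sub {p t N a b : ℕ} (h : p.Coprime N) (hab : a ≤ b) (hb : b < N) :
    gridIntervalSum p t N a b = gridIntervalSum p t N 0 b - gridIntervalSum p t N 0 a := by
  rcases Nat.eq_zero_or_pos a with rfl | ha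
  · rw [gridIntervalSum_self, sub_zero]
  · rw [← gridIntervalSum_add h (Nat.zero_le a) hab hb ha, add_sub_cancel_left]

theorem intervalPowerSum_eq_sub {p t N : ℕ} [Fact p.Prime] (h : p.Coprime N) {x y : ℝ}
    (a b : ℕ) (hx : x = a / N) (hy : y = b / N) (hab : a ≤ b) (hb : b < N) :
    intervalPowerSum p t x y = gridIntervalSum p t N 0 b - gridIntervalSum p t N 0 a := by
  rw [hx, hy, intervalPowerSum_eq_gridIntervalSum (by omega) hb.le, gridIntervalSum_eq_sub h hab hb]

/-! ### Weighted primitives and the five formal identities. -/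

/-- The doubling and tripling relations, with weights `w`, of the primitive `g` of an even
homogeneous function on the grid of mesh `1 / 4608`. -/
structure IsWeightedPrimitive {R : Type*} [CommRing R] (w g : ℕ → R) : Prop where
  zero : g 0 = 0
  half : g 2304 = 0
  -- The image `(b, 2304)` contributes `-g b` because `g 2304 = 0`. The side conditions form one
  -- decidable conjunction, so that numerical instances close by `decide`.
  two : ∀ m m' c a b : ℕ, m' = 2 * m ∧ c = 2 * a ∧ a + b = 2304 ∧ 0 < b →
    w m * g c = w m' * (g a - g b)
  -- The images `(b, 1536)` and `(1536, d)` of the trisection are merged into `(b, d)`.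
  three : ∀ m m' c a b d : ℕ, m' = 3 * m ∧ c = 3 * a ∧ a + b = 1536 ∧ d = 2 * a + b ∧ 0 < b →
    w m * g c = w m' * (g a + g d - g b)

theorem isWeightedPrimitive_gridIntervalSum {p t : ℕ} [Fact p.Prime] (hp : 5 ≤ p) (ht : Even t)
    (ht0 : t ≠ 0) (htp : t < p - 1) {w : ℕ → ZMod p}
    (h2 : ∀ m, w m * 2 ^ t = w (2 * m)) (h3 : ∀ m, w m * 3 ^ t = w (3 * m)) :
    IsWeightedPrimitive w (gridIntervalSum p t 4608 0) := by
  have hpp : p.Prime := Fact.out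
  have hodd : Odd p := hpp.odd_of_ne_two (by omega)
  have hp3 : ¬ 3 ∣ p := fun h => by
    have := (Nat.prime_dvd_prime_iff_eq Nat.prime_three hpp).mp h
    omega
  have hcop : p.Coprime 4608 := by
    rw [show 4608 = 2 ^ 9 * 3 ^ 2 by norm_num]
    exact ((Nat.coprime_two_right.mpr hodd).pow_right 9).mul_right
      (((Nat.Prime.coprime_iff_not_dvd Nat.prime_three).mpr hp3).symm.pow_right 2)
  have hhalf : gridIntervalSum p t 4608 0 2304 = 0 :=
    gridIntervalSum_half (M := 2304) hodd ht ht0 htp (by norm_num)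
  refine ⟨gridIntervalSum_self _ _ _ _, hhalf, ?_, ?_⟩
  · rintro m m' c a b ⟨rfl, rfl, hab, hb⟩
    have h := gridIntervalSum_two_mul (p := p) (t := t) (a := a) (b := b) hodd ht
    rw [hab, gridIntervalSum_eq_sub hcop (a := b) (by omega) (by norm_num), hhalf] at h
    rw [h, ← h2]
    ring
  · rintro m m' c a b d ⟨rfl, rfl, hab, rfl, hb⟩
    have h := gridIntervalSum_three_mul (p := p) (t := t) (a := a) (b := b) hp3 ht
    rw [hab, gridIntervalSum_eq_sub hcop (a := b) (by omega) (by norm_num),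
      gridIntervalSum_eq_sub hcop (a := 1536) (by omega) (by omega)] at h
    rw [h, ← h3]
    ring

namespace IsWeightedPrimitive

variable {R : Type*} [CommRing R] {w g : ℕ → R}

/-- Two successive halvings starting from `1152 / 4608 = 1/4`. -/
theorem eq_comb3 (hg : IsWeightedPrimitive w g) :
    w 1 * g 1152 = w 4 * (g 288 - g 0) + w 2 * (g 2016 - g 1728) +
      (w 2 + w 4) * (g 2304 - g 2016) := by
  rw [hg.zero, hg.half]
  linear_combination hg.two 1 2 1152 576 1728 (by decide) + hg.two 2 4 576 288 2016 (by decide)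

/-- The initial interval `(0, 288)` is halved twice more; the upper images end at 2304 and overlap
intervals already in use. -/
theorem eq_comb5 (hg : IsWeightedPrimitive w g) :
    w 1 * g 1152 = w 16 * (g 72 - g 0) + w 2 * (g 2016 - g 1728) +
      (w 2 + w 4) * (g 2160 - g 2016) + (w 2 + w 4 + w 8) * (g 2232 - g 2160) +
      (w 2 + w 4 + w 8 + w 16) * (g 2304 - g 2232) := by
  have h := hg.eq_comb3
  rw [hg.zero, hg.half] at h ⊢
  linear_combination h + hg.two 4 8 288 144 2160 (by decide)
    + hg.two 8 16 144 72 2232 (by decide)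

/-- The initial interval is halved again, and `(1728, 2016)` with weight `w 2` is trisected into
`(576, 672)`, `(864, 960)` and `(2112, 2208)`; the last lies on intervals already present. -/
theorem eq_comb9 (hg : IsWeightedPrimitive w g) :
    w 1 * g 1152 = w 32 * (g 36 - g 0) + w 6 * (g 672 - g 576) + w 6 * (g 960 - g 864) +
      (w 2 + w 4) * (g 2112 - g 2016) + (w 2 + w 4 + w 6) * (g 2160 - g 2112) +
      (w 2 + w 4 + w 6 + w 8) * (g 2208 - g 2160) + (w 2 + w 4 + w 8) * (g 2232 - g 2208) +
      (w 2 + w 4 + w 8 + w 16) * (g 2268 - g 2232) +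
      (w 2 + w 4 + w 8 + w 16 + w 32) * (g 2304 - g 2268) := by
  have h := hg.eq_comb5
  rw [hg.zero, hg.half] at h ⊢
  linear_combination h + hg.two 16 32 72 36 2268 (by decide)
    + hg.three 2 6 2016 672 864 2208 (by decide) - hg.three 2 6 1728 576 960 2112 (by decide)

/-- Besides halving the initial interval, this halves `(576, 672)`, trisects `(864, 960)`, trisects
the weights `w 2 + w 4` on `(2016, 2112)`, and halves the weights `w 2 + w 4 + w 6` on `(2112,
2160)`. Each relation is used as a difference at the two ends of an interval. -/
theorem eq_comb16 (hg : IsWeightedPrimitive w g) :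
    w 1 * g 1152 = w 64 * (g 18 - g 0) + (w 12 + w 18) * (g 320 - g 288) +
      w 12 * (g 336 - g 320) + (w 6 + w 12) * (g 704 - g 672) + (w 6 + w 12) * (g 864 - g 832) +
      (w 4 + w 8 + w 12) * (g 1080 - g 1056) + w 18 * (g 1224 - g 1216) +
      (w 4 + w 8 + w 12 + w 18) * (g 1248 - g 1224) + w 18 * (g 1856 - g 1824) +
      w 12 * (g 2016 - g 1968) + (w 2 + w 4 + w 6 + w 8) * (g 2208 - g 2160) +
      (w 2 + w 4 + w 6 + w 8 + w 12) * (g 2232 - g 2208) +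
      (w 2 + w 4 + w 6 + w 8 + w 12 + w 16) * (g 2240 - g 2232) +
      (w 2 + w 4 + w 8 + w 16) * (g 2268 - g 2240) +
      (w 2 + w 4 + w 8 + w 16 + w 32) * (g 2286 - g 2268) +
      (w 2 + w 4 + w 8 + w 16 + w 32 + w 64) * (g 2304 - g 2286) := by
  have h := hg.eq_comb9
  rw [hg.zero, hg.half] at h ⊢
  linear_combination h + hg.two 32 64 36 18 2286 (by decide)
    + hg.two 6 12 672 336 1968 (by decide) - hg.two 6 12 576 288 2016 (by decide)
    + hg.three 6 18 960 320 1216 1856 (by decide) - hg.three 6 18 864 288 1248 1824 (by decide)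
    + hg.three 2 6 2112 704 832 2240 (by decide) + hg.three 4 12 2112 704 832 2240 (by decide)
    - hg.three 2 6 2016 672 864 2208 (by decide) - hg.three 4 12 2016 672 864 2208 (by decide)
    + hg.two 2 4 2160 1080 1224 (by decide) + hg.two 4 8 2160 1080 1224 (by decide)
    + hg.two 6 12 2160 1080 1224 (by decide) - hg.two 2 4 2112 1056 1248 (by decide)
    - hg.two 4 8 2112 1056 1248 (by decide) - hg.two 6 12 2112 1056 1248 (by decide)

/-- Besides halving the initial interval, the weights `w 12 + w 18` on `(288, 320)` are moved by two
rounds of halving through `(144, 160)` and `(2144, 2160)`. Then `(1968, 2016)` with `w 12` is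
trisected and its image `(656, 672)` halved, and `w 2 + w 4 + w 6 + w 8` on `(2160, 2192)` is
halved. -/
theorem eq_comb24 (hg : IsWeightedPrimitive w g) :
    w 1 * g 1152 = w 128 * (g 9 - g 0) + (w 48 + w 72) * (g 80 - g 72) + w 12 * (g 328 - g 320) +
      (w 12 + w 72) * (g 336 - g 328) + (w 6 + w 12) * (g 704 - g 672) +
      (w 6 + w 12) * (g 864 - g 832) + w 36 * (g 880 - g 864) +
      (w 4 + w 8 + w 12) * (g 1072 - g 1056) +
      (w 4 + w 8 + w 12 + w 48 + w 72) * (g 1080 - g 1072) +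
      (w 4 + w 8 + w 12 + w 16) * (g 1096 - g 1080) +
      (w 4 + w 8 + w 12 + w 16) * (g 1216 - g 1208) +
      (w 4 + w 8 + w 12 + w 16 + w 18) * (g 1224 - g 1216) +
      (w 4 + w 8 + w 12 + w 18 + w 48 + w 72) * (g 1232 - g 1224) +
      (w 4 + w 8 + w 12 + w 18) * (g 1248 - g 1232) + w 18 * (g 1856 - g 1824) +
      w 72 * (g 1976 - g 1968) + (w 2 + w 4 + w 6 + w 8 + w 36) * (g 2208 - g 2192) +
      (w 2 + w 4 + w 6 + w 8 + w 12) * (g 2224 - g 2208) +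
      (w 2 + w 4 + w 6 + w 8 + w 12 + w 48 + w 72) * (g 2232 - g 2224) +
      (w 2 + w 4 + w 6 + w 8 + w 12 + w 16) * (g 2240 - g 2232) +
      (w 2 + w 4 + w 8 + w 16) * (g 2268 - g 2240) +
      (w 2 + w 4 + w 8 + w 16 + w 32) * (g 2286 - g 2268) +
      (w 2 + w 4 + w 8 + w 16 + w 32 + w 64) * (g 2295 - g 2286) +
      (w 2 + w 4 + w 8 + w 16 + w 32 + w 64 + w 128) * (g 2304 - g 2295) := by
  have h := hg.eq_comb16
  rw [hg.zero, hg.half] at h ⊢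
  linear_combination h + hg.two 64 128 18 9 2295 (by decide)
    + hg.two 12 24 320 160 2144 (by decide) + hg.two 18 36 320 160 2144 (by decide)
    - hg.two 12 24 288 144 2160 (by decide) - hg.two 18 36 288 144 2160 (by decide)
    + hg.two 24 48 160 80 2224 (by decide) + hg.two 36 72 160 80 2224 (by decide)
    - hg.two 24 48 144 72 2232 (by decide) - hg.two 36 72 144 72 2232 (by decide)
    + hg.two 24 48 2160 1080 1224 (by decide) + hg.two 36 72 2160 1080 1224 (by decide)
    - hg.two 24 48 2144 1072 1232 (by decide) - hg.two 36 72 2144 1072 1232 (by decide)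
    + hg.three 12 36 2016 672 864 2208 (by decide) - hg.three 12 36 1968 656 880 2192 (by decide)
    + hg.two 36 72 672 336 1968 (by decide) - hg.two 36 72 656 328 1976 (by decide)
    + hg.two 2 4 2192 1096 1208 (by decide) + hg.two 4 8 2192 1096 1208 (by decide)
    + hg.two 6 12 2192 1096 1208 (by decide) + hg.two 8 16 2192 1096 1208 (by decide)
    - hg.two 2 4 2160 1080 1224 (by decide) - hg.two 4 8 2160 1080 1224 (by decide)
    - hg.two 6 12 2160 1080 1224 (by decide) - hg.two 8 16 2160 1080 1224 (by decide)

end IsWeightedPrimitive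

/-! ### The combinations written as differences of a grid primitive. -/

/-- `g` is a primitive of the interval sums with end points on the grid of mesh `1 / 4608`. -/
def IsGridPrimitive (p : ℕ) [Fact p.Prime] (l : ℤ) (g : ℕ → ZMod p) : Prop :=
  ∀ (a b : ℕ) {x y : ℝ}, x * 4608 = a ∧ y * 4608 = b ∧ a ≤ b ∧ b < 4608 →
    intervalPowerSum p l x y = g b - g a

theorem isGridPrimitive_gridIntervalSum {p t : ℕ} [Fact p.Prime] (h : p.Coprime 4608) :
    IsGridPrimitive p t (gridIntervalSum p t 4608 0) := by
  rintro a b x y ⟨hx, hy, hab, hb⟩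
  refine intervalPowerSum_eq_sub h a b ?_ ?_ hab hb
  · rw [← hx]; norm_num
  · rw [← hy]; norm_num

/-- Here and in the companions for 5, 9, 16 and 24 sums, the right side is that of the corresponding
`eq_comb` lemma for the weights `w m = m ^ t`. -/
theorem combinationValue_eulerComb3 {p : ℕ} [Fact p.Prime] {l : ℤ} {t : ℕ} {g : ℕ → ZMod p}
    (hg : IsGridPrimitive p l g) :
    combinationValue p l (eulerComb3 t) = 4 ^ t * (g 288 - g 0) + 2 ^ t * (g 2016 - g 1728) +
      (2 ^ t + 4 ^ t) * (g 2304 - g 2016) := by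
  simp only [combinationValue, eulerComb3, List.map_cons, List.map_nil, List.sum_cons, List.sum_nil]
  rw [hg 0 288 (by norm_num), hg 1728 2016 (by norm_num), hg 2016 2304 (by norm_num)]
  push_cast
  ring

theorem combinationValue_eulerComb5 {p : ℕ} [Fact p.Prime] {l : ℤ} {t : ℕ} {g : ℕ → ZMod p}
    (hg : IsGridPrimitive p l g) :
    combinationValue p l (eulerComb5 t) = 16 ^ t * (g 72 - g 0) + 2 ^ t * (g 2016 - g 1728) +
      (2 ^ t + 4 ^ t) * (g 2160 - g 2016) + (2 ^ t + 4 ^ t + 8 ^ t) * (g 2232 - g 2160) +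
      (2 ^ t + 4 ^ t + 8 ^ t + 16 ^ t) * (g 2304 - g 2232) := by
  simp only [combinationValue, eulerComb5, List.map_cons, List.map_nil, List.sum_cons, List.sum_nil]
  rw [hg 0 72 (by norm_num), hg 1728 2016 (by norm_num), hg 2016 2160 (by norm_num),
    hg 2160 2232 (by norm_num), hg 2232 2304 (by norm_num)]
  push_cast
  ring

theorem combinationValue_eulerComb9 {p : ℕ} [Fact p.Prime] {l : ℤ} {t : ℕ} {g : ℕ → ZMod p}
    (hg : IsGridPrimitive p l g) :
    combinationValue p l (eulerComb9 t) = 32 ^ t * (g 36 - g 0) + 6 ^ t * (g 672 - g 576) +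
      6 ^ t * (g 960 - g 864) + (2 ^ t + 4 ^ t) * (g 2112 - g 2016) +
      (2 ^ t + 4 ^ t + 6 ^ t) * (g 2160 - g 2112) +
      (2 ^ t + 4 ^ t + 6 ^ t + 8 ^ t) * (g 2208 - g 2160) +
      (2 ^ t + 4 ^ t + 8 ^ t) * (g 2232 - g 2208) +
      (2 ^ t + 4 ^ t + 8 ^ t + 16 ^ t) * (g 2268 - g 2232) +
      (2 ^ t + 4 ^ t + 8 ^ t + 16 ^ t + 32 ^ t) * (g 2304 - g 2268) := by
  simp only [combinationValue, eulerComb9, List.map_cons, List.map_nil, List.sum_cons, List.sum_nil]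
  rw [hg 0 36 (by norm_num), hg 576 672 (by norm_num), hg 864 960 (by norm_num),
    hg 2016 2112 (by norm_num), hg 2112 2160 (by norm_num), hg 2160 2208 (by norm_num),
    hg 2208 2232 (by norm_num), hg 2232 2268 (by norm_num), hg 2268 2304 (by norm_num)]
  push_cast
  ring

theorem combinationValue_eulerComb16 {p : ℕ} [Fact p.Prime] {l : ℤ} {t : ℕ} {g : ℕ → ZMod p}
    (hg : IsGridPrimitive p l g) :
    combinationValue p l (eulerComb16 t) = 64 ^ t * (g 18 - g 0) +
      (12 ^ t + 18 ^ t) * (g 320 - g 288) + 12 ^ t * (g 336 - g 320) +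
      (6 ^ t + 12 ^ t) * (g 704 - g 672) + (6 ^ t + 12 ^ t) * (g 864 - g 832) +
      (4 ^ t + 8 ^ t + 12 ^ t) * (g 1080 - g 1056) + 18 ^ t * (g 1224 - g 1216) +
      (4 ^ t + 8 ^ t + 12 ^ t + 18 ^ t) * (g 1248 - g 1224) + 18 ^ t * (g 1856 - g 1824) +
      12 ^ t * (g 2016 - g 1968) + (2 ^ t + 4 ^ t + 6 ^ t + 8 ^ t) * (g 2208 - g 2160) +
      (2 ^ t + 4 ^ t + 6 ^ t + 8 ^ t + 12 ^ t) * (g 2232 - g 2208) +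
      (2 ^ t + 4 ^ t + 6 ^ t + 8 ^ t + 12 ^ t + 16 ^ t) * (g 2240 - g 2232) +
      (2 ^ t + 4 ^ t + 8 ^ t + 16 ^ t) * (g 2268 - g 2240) +
      (2 ^ t + 4 ^ t + 8 ^ t + 16 ^ t + 32 ^ t) * (g 2286 - g 2268) +
      (2 ^ t + 4 ^ t + 8 ^ t + 16 ^ t + 32 ^ t + 64 ^ t) * (g 2304 - g 2286) := by
  simp only [combinationValue, eulerComb16, List.map_cons, List.map_nil, List.sum_cons, List.sum_nil]
  rw [hg 0 18 (by norm_num), hg 288 320 (by norm_num), hg 320 336 (by norm_num),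
    hg 672 704 (by norm_num), hg 832 864 (by norm_num), hg 1056 1080 (by norm_num),
    hg 1216 1224 (by norm_num), hg 1224 1248 (by norm_num), hg 1824 1856 (by norm_num),
    hg 1968 2016 (by norm_num), hg 2160 2208 (by norm_num), hg 2208 2232 (by norm_num),
    hg 2232 2240 (by norm_num), hg 2240 2268 (by norm_num), hg 2268 2286 (by norm_num),
    hg 2286 2304 (by norm_num)]
  push_cast
  ring

theorem combinationValue_eulerComb24 {p : ℕ} [Fact p.Prime] {l : ℤ} {t : ℕ} {g : ℕ → ZMod p}
    (hg : IsGridPrimitive p l g) :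
    combinationValue p l (eulerComb24 t) = 128 ^ t * (g 9 - g 0) +
      (48 ^ t + 72 ^ t) * (g 80 - g 72) + 12 ^ t * (g 328 - g 320) +
      (12 ^ t + 72 ^ t) * (g 336 - g 328) + (6 ^ t + 12 ^ t) * (g 704 - g 672) +
      (6 ^ t + 12 ^ t) * (g 864 - g 832) + 36 ^ t * (g 880 - g 864) +
      (4 ^ t + 8 ^ t + 12 ^ t) * (g 1072 - g 1056) +
      (4 ^ t + 8 ^ t + 12 ^ t + 48 ^ t + 72 ^ t) * (g 1080 - g 1072) +
      (4 ^ t + 8 ^ t + 12 ^ t + 16 ^ t) * (g 1096 - g 1080) +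
      (4 ^ t + 8 ^ t + 12 ^ t + 16 ^ t) * (g 1216 - g 1208) +
      (4 ^ t + 8 ^ t + 12 ^ t + 16 ^ t + 18 ^ t) * (g 1224 - g 1216) +
      (4 ^ t + 8 ^ t + 12 ^ t + 18 ^ t + 48 ^ t + 72 ^ t) * (g 1232 - g 1224) +
      (4 ^ t + 8 ^ t + 12 ^ t + 18 ^ t) * (g 1248 - g 1232) + 18 ^ t * (g 1856 - g 1824) +
      72 ^ t * (g 1976 - g 1968) + (2 ^ t + 4 ^ t + 6 ^ t + 8 ^ t + 36 ^ t) * (g 2208 - g 2192) +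
      (2 ^ t + 4 ^ t + 6 ^ t + 8 ^ t + 12 ^ t) * (g 2224 - g 2208) +
      (2 ^ t + 4 ^ t + 6 ^ t + 8 ^ t + 12 ^ t + 48 ^ t + 72 ^ t) * (g 2232 - g 2224) +
      (2 ^ t + 4 ^ t + 6 ^ t + 8 ^ t + 12 ^ t + 16 ^ t) * (g 2240 - g 2232) +
      (2 ^ t + 4 ^ t + 8 ^ t + 16 ^ t) * (g 2268 - g 2240) +
      (2 ^ t + 4 ^ t + 8 ^ t + 16 ^ t + 32 ^ t) * (g 2286 - g 2268) +
      (2 ^ t + 4 ^ t + 8 ^ t + 16 ^ t + 32 ^ t + 64 ^ t) * (g 2295 - g 2286) +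
      (2 ^ t + 4 ^ t + 8 ^ t + 16 ^ t + 32 ^ t + 64 ^ t + 128 ^ t) * (g 2304 - g 2295) := by
  simp only [combinationValue, eulerComb24, List.map_cons, List.map_nil, List.sum_cons, List.sum_nil]
  rw [hg 0 9 (by norm_num), hg 72 80 (by norm_num), hg 320 328 (by norm_num),
    hg 328 336 (by norm_num), hg 672 704 (by norm_num), hg 832 864 (by norm_num),
    hg 864 880 (by norm_num), hg 1056 1072 (by norm_num), hg 1072 1080 (by norm_num),
    hg 1080 1096 (by norm_num), hg 1208 1216 (by norm_num), hg 1216 1224 (by norm_num),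
    hg 1224 1232 (by norm_num), hg 1232 1248 (by norm_num), hg 1824 1856 (by norm_num),
    hg 1968 1976 (by norm_num), hg 2192 2208 (by norm_num), hg 2208 2224 (by norm_num),
    hg 2224 2232 (by norm_num), hg 2232 2240 (by norm_num), hg 2240 2268 (by norm_num),
    hg 2268 2286 (by norm_num), hg 2286 2295 (by norm_num), hg 2295 2304 (by norm_num)]
  push_cast
  ring

/-- The integer coefficients here and in the four companions are the sums of weights in the
`eq_comb` lemmas at `w m = Q / m ^ 2`, with `Q` the square of the least common multiple of the
indices `m` that occur. -/
theorem combinationValue_vandiverComb3 {p : ℕ} [Fact p.Prime] {l : ℤ} {g : ℕ → ZMod p}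
    (hg : IsGridPrimitive p l g) :
    combinationValue p l vandiverComb3 = 1 * (g 288 - g 0) + 4 * (g 2016 - g 1728) +
      5 * (g 2304 - g 2016) := by
  simp only [combinationValue, vandiverComb3, List.map_cons, List.map_nil, List.sum_cons, List.sum_nil]
  rw [hg 0 288 (by norm_num), hg 1728 2016 (by norm_num), hg 2016 2304 (by norm_num)]
  push_cast
  ring

theorem combinationValue_vandiverComb5 {p : ℕ} [Fact p.Prime] {l : ℤ} {g : ℕ → ZMod p}
    (hg : IsGridPrimitive p l g) :
    combinationValue p l vandiverComb5 = 1 * (g 72 - g 0) + 64 * (g 2016 - g 1728) +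
      80 * (g 2160 - g 2016) + 84 * (g 2232 - g 2160) + 85 * (g 2304 - g 2232) := by
  simp only [combinationValue, vandiverComb5, List.map_cons, List.map_nil, List.sum_cons, List.sum_nil]
  rw [hg 0 72 (by norm_num), hg 1728 2016 (by norm_num), hg 2016 2160 (by norm_num),
    hg 2160 2232 (by norm_num), hg 2232 2304 (by norm_num)]
  push_cast
  ring

theorem combinationValue_vandiverComb9 {p : ℕ} [Fact p.Prime] {l : ℤ} {g : ℕ → ZMod p}
    (hg : IsGridPrimitive p l g) :
    combinationValue p l vandiverComb9 = 9 * (g 36 - g 0) + 256 * (g 672 - g 576) +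
      256 * (g 960 - g 864) + 2880 * (g 2112 - g 2016) + 3136 * (g 2160 - g 2112) +
      3280 * (g 2208 - g 2160) + 3024 * (g 2232 - g 2208) + 3060 * (g 2268 - g 2232) +
      3069 * (g 2304 - g 2268) := by
  simp only [combinationValue, vandiverComb9, List.map_cons, List.map_nil, List.sum_cons, List.sum_nil]
  rw [hg 0 36 (by norm_num), hg 576 672 (by norm_num), hg 864 960 (by norm_num),
    hg 2016 2112 (by norm_num), hg 2112 2160 (by norm_num), hg 2160 2208 (by norm_num),
    hg 2208 2232 (by norm_num), hg 2232 2268 (by norm_num), hg 2268 2304 (by norm_num)]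
  push_cast
  ring

theorem combinationValue_vandiverComb16 {p : ℕ} [Fact p.Prime] {l : ℤ} {g : ℕ → ZMod p}
    (hg : IsGridPrimitive p l g) :
    combinationValue p l vandiverComb16 = 81 * (g 18 - g 0) + 3328 * (g 320 - g 288) +
      2304 * (g 336 - g 320) + 11520 * (g 704 - g 672) + 11520 * (g 864 - g 832) +
      28224 * (g 1080 - g 1056) + 1024 * (g 1224 - g 1216) + 29248 * (g 1248 - g 1224) +
      1024 * (g 1856 - g 1824) + 2304 * (g 2016 - g 1968) + 118080 * (g 2208 - g 2160) +
      120384 * (g 2232 - g 2208) + 121680 * (g 2240 - g 2232) + 110160 * (g 2268 - g 2240) +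
      110484 * (g 2286 - g 2268) + 110565 * (g 2304 - g 2286) := by
  simp only [combinationValue, vandiverComb16, List.map_cons, List.map_nil, List.sum_cons, List.sum_nil]
  rw [hg 0 18 (by norm_num), hg 288 320 (by norm_num), hg 320 336 (by norm_num),
    hg 672 704 (by norm_num), hg 832 864 (by norm_num), hg 1056 1080 (by norm_num),
    hg 1216 1224 (by norm_num), hg 1224 1248 (by norm_num), hg 1824 1856 (by norm_num),
    hg 1968 2016 (by norm_num), hg 2160 2208 (by norm_num), hg 2208 2232 (by norm_num),
    hg 2232 2240 (by norm_num), hg 2240 2268 (by norm_num), hg 2268 2286 (by norm_num),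
    hg 2286 2304 (by norm_num)]
  push_cast
  ring

theorem combinationValue_vandiverComb24 {p : ℕ} [Fact p.Prime] {l : ℤ} {g : ℕ → ZMod p}
    (hg : IsGridPrimitive p l g) :
    combinationValue p l vandiverComb24 = 81 * (g 9 - g 0) + 832 * (g 80 - g 72) +
      9216 * (g 328 - g 320) + 9472 * (g 336 - g 328) + 46080 * (g 704 - g 672) +
      46080 * (g 864 - g 832) + 1024 * (g 880 - g 864) + 112896 * (g 1072 - g 1056) +
      113728 * (g 1080 - g 1072) + 118080 * (g 1096 - g 1080) + 118080 * (g 1216 - g 1208) +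
      122176 * (g 1224 - g 1216) + 117824 * (g 1232 - g 1224) + 116992 * (g 1248 - g 1232) +
      4096 * (g 1856 - g 1824) + 256 * (g 1976 - g 1968) + 473344 * (g 2208 - g 2192) +
      481536 * (g 2224 - g 2208) + 482368 * (g 2232 - g 2224) + 486720 * (g 2240 - g 2232) +
      440640 * (g 2268 - g 2240) + 441936 * (g 2286 - g 2268) + 442260 * (g 2295 - g 2286) +
      442341 * (g 2304 - g 2295) := by
  simp only [combinationValue, vandiverComb24, List.map_cons, List.map_nil, List.sum_cons, List.sum_nil]
  rw [hg 0 9 (by norm_num), hg 72 80 (by norm_num), hg 320 328 (by norm_num),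
    hg 328 336 (by norm_num), hg 672 704 (by norm_num), hg 832 864 (by norm_num),
    hg 864 880 (by norm_num), hg 1056 1072 (by norm_num), hg 1072 1080 (by norm_num),
    hg 1080 1096 (by norm_num), hg 1208 1216 (by norm_num), hg 1216 1224 (by norm_num),
    hg 1224 1232 (by norm_num), hg 1232 1248 (by norm_num), hg 1824 1856 (by norm_num),
    hg 1968 1976 (by norm_num), hg 2192 2208 (by norm_num), hg 2208 2224 (by norm_num),
    hg 2224 2232 (by norm_num), hg 2232 2240 (by norm_num), hg 2240 2268 (by norm_num),
    hg 2268 2286 (by norm_num), hg 2286 2295 (by norm_num), hg 2295 2304 (by norm_num)]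
  push_cast
  ring

/-! ### Admissible weights for the exponents `t` and `-2`. -/

theorem coprime_two_pow_mul_three_pow {p : ℕ} [Fact p.Prime] (hp : 5 ≤ p) (i j : ℕ) :
    p.Coprime (2 ^ i * 3 ^ j) := by
  have hpp : p.Prime := Fact.out
  have h2 : p.Coprime 2 := (Nat.coprime_primes hpp Nat.prime_two).mpr (by omega)
  have h3 : p.Coprime 3 := (Nat.coprime_primes hpp Nat.prime_three).mpr (by omega)
  exact (h2.pow_right i).mul_right (h3.pow_right j)

theorem isWeightedPrimitive_pow {p t : ℕ} [Fact p.Prime] (hp : 5 ≤ p) (ht : Even t)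
    (ht0 : t ≠ 0) (htp : t < p - 1) :
    IsWeightedPrimitive (fun m => (m : ZMod p) ^ t) (gridIntervalSum p t 4608 0) := by
  refine isWeightedPrimitive_gridIntervalSum hp ht ht0 htp ?_ ?_ <;>
  · intro m
    push_cast
    rw [mul_pow, mul_comm]

theorem ZMod.pow_sub_three {p : ℕ} [Fact p.Prime] (hp : 5 ≤ p) (z : ZMod p) :
    z ^ (p - 3) = (z ^ 2)⁻¹ := by
  by_cases hz : z = 0
  -- At `z = 0` both sides are `0`, by `p - 3 > 0` and the convention `0⁻¹ = 0`.
  · rw [hz, zero_pow (by omega)]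
    simp
  · apply eq_inv_of_mul_eq_one_left
    rw [← pow_add, show p - 3 + 2 = p - 1 by omega]
    exact ZMod.pow_card_sub_one_eq_one hz

theorem intervalPowerSum_neg_two {p : ℕ} [Fact p.Prime] (hp : 5 ≤ p) (x y : ℝ) :
    intervalPowerSum p (-2) x y = intervalPowerSum p ((p - 3 : ℕ) : ℤ) x y := by
  refine sum_congr rfl fun s _ => ?_
  rw [zpow_natCast, ZMod.pow_sub_three hp, zpow_neg, zpow_ofNat]

/-- For exponent `p - 3` the weights `Q / m ^ 2` are admissible. -/
theorem exists_isWeightedPrimitive_inv_sq {p Q : ℕ} [Fact p.Prime] (hp : 5 ≤ p)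
    (hQ : p.Coprime Q) :
    ∃ w : ℕ → ZMod p, IsWeightedPrimitive w (gridIntervalSum p (p - 3) 4608 0) ∧
      ∀ m c : ℕ, Q = c * m ^ 2 → w m = c := by
  have hodd := Nat.odd_iff.mp ((Fact.out : p.Prime).odd_of_ne_two (by omega))
  -- The scaling conditions hold because `2 ^ (p - 3)` and `3 ^ (p - 3)` are the inverses of `2 ^ 2`
  -- and `3 ^ 2`.
  refine ⟨fun m => Q * ((m : ZMod p) ^ 2)⁻¹, isWeightedPrimitive_gridIntervalSum hp
    (Nat.even_iff.mpr (by omega)) (by omega) (by omega) ?_ ?_, ?_⟩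
  · intro m
    rw [ZMod.pow_sub_three hp]
    push_cast
    rw [mul_pow, mul_inv]
    ring
  · intro m
    rw [ZMod.pow_sub_three hp]
    push_cast
    rw [mul_pow, mul_inv]
    ring
  · intro m c h
    -- `m` divides `Q`, so it is invertible modulo `p` and `Q / m ^ 2` is the integer `c`.
    have hm : p.Coprime m := by
      refine hQ.coprime_dvd_right ?_
      rw [h, pow_two, ← mul_assoc]
      exact Dvd.intro_left _ rfl
    rw [h]
    push_cast
    exact mul_inv_cancel_right₀ (pow_ne_zero 2 (ZMod.natCast_ne_zero_of_coprime hm)) _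

/-! ### The ten congruences, the costs and the theorem. -/

theorem eulerNumber_eq_combinationValue_eulerComb3 {p t k : ℕ} [Fact p.Prime] (hp : 5 ≤ p)
    (hk : 1 ≤ k) (ht : t + 2 * k = p - 1) (ht0 : t ≠ 0) :
    (-1) ^ k * 4 ^ (2 * k - 1) * (eulerNumber t : ZMod p) =
      combinationValue p t (eulerComb3 t) := by
  have hodd := (Fact.out : p.Prime).odd_of_ne_two (by omega)
  have hpar := Nat.odd_iff.mp hodd
  have h := (isWeightedPrimitive_pow hp (Nat.even_iff.mpr (by omega)) ht0 (by omega)).eq_comb3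
  simp only [Nat.cast_one, one_pow, one_mul, Nat.cast_ofNat] at h
  rw [combinationValue_eulerComb3 (isGridPrimitive_gridIntervalSum
    (coprime_two_pow_mul_three_pow hp 9 2)), ← h]
  exact eulerNumber_eq_gridIntervalSum (M := 1152) hodd hk ht ht0 (by norm_num)

theorem eulerNumber_eq_combinationValue_eulerComb5 {p t k : ℕ} [Fact p.Prime] (hp : 5 ≤ p)
    (hk : 1 ≤ k) (ht : t + 2 * k = p - 1) (ht0 : t ≠ 0) :
    (-1) ^ k * 4 ^ (2 * k - 1) * (eulerNumber t : ZMod p) =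
      combinationValue p t (eulerComb5 t) := by
  have hodd := (Fact.out : p.Prime).odd_of_ne_two (by omega)
  have hpar := Nat.odd_iff.mp hodd
  have h := (isWeightedPrimitive_pow hp (Nat.even_iff.mpr (by omega)) ht0 (by omega)).eq_comb5
  simp only [Nat.cast_one, one_pow, one_mul, Nat.cast_ofNat] at h
  rw [combinationValue_eulerComb5 (isGridPrimitive_gridIntervalSum
    (coprime_two_pow_mul_three_pow hp 9 2)), ← h]
  exact eulerNumber_eq_gridIntervalSum (M := 1152) hodd hk ht ht0 (by norm_num)

theorem eulerNumber_eq_combinationValue_eulerComb9 {p t k : ℕ} [Fact p.Prime] (hp : 5 ≤ p)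
    (hk : 1 ≤ k) (ht : t + 2 * k = p - 1) (ht0 : t ≠ 0) :
    (-1) ^ k * 4 ^ (2 * k - 1) * (eulerNumber t : ZMod p) =
      combinationValue p t (eulerComb9 t) := by
  have hodd := (Fact.out : p.Prime).odd_of_ne_two (by omega)
  have hpar := Nat.odd_iff.mp hodd
  have h := (isWeightedPrimitive_pow hp (Nat.even_iff.mpr (by omega)) ht0 (by omega)).eq_comb9
  simp only [Nat.cast_one, one_pow, one_mul, Nat.cast_ofNat] at h
  rw [combinationValue_eulerComb9 (isGridPrimitive_gridIntervalSum
    (coprime_two_pow_mul_three_pow hp 9 2)), ← h]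
  exact eulerNumber_eq_gridIntervalSum (M := 1152) hodd hk ht ht0 (by norm_num)

theorem eulerNumber_eq_combinationValue_eulerComb16 {p t k : ℕ} [Fact p.Prime] (hp : 5 ≤ p)
    (hk : 1 ≤ k) (ht : t + 2 * k = p - 1) (ht0 : t ≠ 0) :
    (-1) ^ k * 4 ^ (2 * k - 1) * (eulerNumber t : ZMod p) =
      combinationValue p t (eulerComb16 t) := by
  have hodd := (Fact.out : p.Prime).odd_of_ne_two (by omega)
  have hpar := Nat.odd_iff.mp hodd
  have h := (isWeightedPrimitive_pow hp (Nat.even_iff.mpr (by omega)) ht0 (by omega)).eq_comb16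
  simp only [Nat.cast_one, one_pow, one_mul, Nat.cast_ofNat] at h
  rw [combinationValue_eulerComb16 (isGridPrimitive_gridIntervalSum
    (coprime_two_pow_mul_three_pow hp 9 2)), ← h]
  exact eulerNumber_eq_gridIntervalSum (M := 1152) hodd hk ht ht0 (by norm_num)

theorem eulerNumber_eq_combinationValue_eulerComb24 {p t k : ℕ} [Fact p.Prime] (hp : 5 ≤ p)
    (hk : 1 ≤ k) (ht : t + 2 * k = p - 1) (ht0 : t ≠ 0) :
    (-1) ^ k * 4 ^ (2 * k - 1) * (eulerNumber t : ZMod p) =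
      combinationValue p t (eulerComb24 t) := by
  have hodd := (Fact.out : p.Prime).odd_of_ne_two (by omega)
  have hpar := Nat.odd_iff.mp hodd
  have h := (isWeightedPrimitive_pow hp (Nat.even_iff.mpr (by omega)) ht0 (by omega)).eq_comb24
  simp only [Nat.cast_one, one_pow, one_mul, Nat.cast_ofNat] at h
  rw [combinationValue_eulerComb24 (isGridPrimitive_gridIntervalSum
    (coprime_two_pow_mul_three_pow hp 9 2)), ← h]
  exact eulerNumber_eq_gridIntervalSum (M := 1152) hodd hk ht ht0 (by norm_num)

theorem eulerNumber_eq_combinationValue_vandiverComb3 {p : ℕ} [Fact p.Prime] (hp : 5 ≤ p) :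
    (-64) * (eulerNumber (p - 3) : ZMod p) = combinationValue p (-2) vandiverComb3 := by
  have hodd := (Fact.out : p.Prime).odd_of_ne_two (by omega)
  -- `Q = 4 ^ 2` clears the weights `1 / m ^ 2` for `m = 1, 2, 4`. The case `k = 1` reads `-4
  -- E_{p-3} = S(0, 1/4)`, whence the factor `-4 Q = -64`.
  obtain ⟨w, hg, hw⟩ := exists_isWeightedPrimitive_inv_sq (Q := 16) hp
    (coprime_two_pow_mul_three_pow hp 4 0)
  have h := hg.eq_comb3
  rw [hw 1 16 (by norm_num), hw 2 4 (by norm_num), hw 4 1 (by norm_num)] at h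
  have hE := eulerNumber_eq_gridIntervalSum (t := p - 3) (k := 1) (M := 1152) hodd le_rfl
    (by omega) (by omega) (by norm_num)
  have hprim : IsGridPrimitive p (-2) (gridIntervalSum p (p - 3) 4608 0) := by
    intro a b x y hxy
    rw [intervalPowerSum_neg_two hp]
    exact isGridPrimitive_gridIntervalSum (coprime_two_pow_mul_three_pow hp 9 2) a b hxy
  rw [combinationValue_vandiverComb3 hprim]
  push_cast at h
  norm_num at hE
  linear_combination 16 * hE + h

theorem eulerNumber_eq_combinationValue_vandiverComb5 {p : ℕ} [Fact p.Prime] (hp : 5 ≤ p) :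
    (-1024) * (eulerNumber (p - 3) : ZMod p) = combinationValue p (-2) vandiverComb5 := by
  have hodd := (Fact.out : p.Prime).odd_of_ne_two (by omega)
  obtain ⟨w, hg, hw⟩ := exists_isWeightedPrimitive_inv_sq (Q := 256) hp
    (coprime_two_pow_mul_three_pow hp 8 0)
  have h := hg.eq_comb5
  rw [hw 1 256 (by norm_num), hw 2 64 (by norm_num), hw 4 16 (by norm_num), hw 8 4 (by norm_num),
    hw 16 1 (by norm_num)] at h
  have hE := eulerNumber_eq_gridIntervalSum (t := p - 3) (k := 1) (M := 1152) hodd le_rfl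
    (by omega) (by omega) (by norm_num)
  have hprim : IsGridPrimitive p (-2) (gridIntervalSum p (p - 3) 4608 0) := by
    intro a b x y hxy
    rw [intervalPowerSum_neg_two hp]
    exact isGridPrimitive_gridIntervalSum (coprime_two_pow_mul_three_pow hp 9 2) a b hxy
  rw [combinationValue_vandiverComb5 hprim]
  push_cast at h
  norm_num at hE
  linear_combination 256 * hE + h

theorem eulerNumber_eq_combinationValue_vandiverComb9 {p : ℕ} [Fact p.Prime] (hp : 5 ≤ p) :
    (-36864) * (eulerNumber (p - 3) : ZMod p) = combinationValue p (-2) vandiverComb9 := by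
  have hodd := (Fact.out : p.Prime).odd_of_ne_two (by omega)
  -- `9216 = 96 ^ 2` with `96 = lcm(6, 32)`.
  obtain ⟨w, hg, hw⟩ := exists_isWeightedPrimitive_inv_sq (Q := 9216) hp
    (coprime_two_pow_mul_three_pow hp 10 2)
  have h := hg.eq_comb9
  rw [hw 1 9216 (by norm_num), hw 2 2304 (by norm_num), hw 4 576 (by norm_num),
    hw 6 256 (by norm_num), hw 8 144 (by norm_num), hw 16 36 (by norm_num), hw 32 9 (by norm_num)] at h
  have hE := eulerNumber_eq_gridIntervalSum (t := p - 3) (k := 1) (M := 1152) hodd le_rfl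
    (by omega) (by omega) (by norm_num)
  have hprim : IsGridPrimitive p (-2) (gridIntervalSum p (p - 3) 4608 0) := by
    intro a b x y hxy
    rw [intervalPowerSum_neg_two hp]
    exact isGridPrimitive_gridIntervalSum (coprime_two_pow_mul_three_pow hp 9 2) a b hxy
  rw [combinationValue_vandiverComb9 hprim]
  push_cast at h
  norm_num at hE
  linear_combination 9216 * hE + h

theorem eulerNumber_eq_combinationValue_vandiverComb16 {p : ℕ} [Fact p.Prime] (hp : 5 ≤ p) :
    (-1327104) * (eulerNumber (p - 3) : ZMod p) = combinationValue p (-2) vandiverComb16 := by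
  have hodd := (Fact.out : p.Prime).odd_of_ne_two (by omega)
  -- `331776 = 576 ^ 2` with `576 = lcm(18, 64)`.
  obtain ⟨w, hg, hw⟩ := exists_isWeightedPrimitive_inv_sq (Q := 331776) hp
    (coprime_two_pow_mul_three_pow hp 12 4)
  have h := hg.eq_comb16
  rw [hw 1 331776 (by norm_num), hw 2 82944 (by norm_num), hw 4 20736 (by norm_num),
    hw 6 9216 (by norm_num), hw 8 5184 (by norm_num), hw 12 2304 (by norm_num),
    hw 16 1296 (by norm_num), hw 18 1024 (by norm_num), hw 32 324 (by norm_num),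
    hw 64 81 (by norm_num)] at h
  have hE := eulerNumber_eq_gridIntervalSum (t := p - 3) (k := 1) (M := 1152) hodd le_rfl
    (by omega) (by omega) (by norm_num)
  have hprim : IsGridPrimitive p (-2) (gridIntervalSum p (p - 3) 4608 0) := by
    intro a b x y hxy
    rw [intervalPowerSum_neg_two hp]
    exact isGridPrimitive_gridIntervalSum (coprime_two_pow_mul_three_pow hp 9 2) a b hxy
  rw [combinationValue_vandiverComb16 hprim]
  push_cast at h
  norm_num at hE
  linear_combination 331776 * hE + h

theorem eulerNumber_eq_combinationValue_vandiverComb24 {p : ℕ} [Fact p.Prime] (hp : 5 ≤ p) :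
    (-5308416) * (eulerNumber (p - 3) : ZMod p) = combinationValue p (-2) vandiverComb24 := by
  have hodd := (Fact.out : p.Prime).odd_of_ne_two (by omega)
  -- `1327104 = 1152 ^ 2` with `1152 = lcm(72, 128)`.
  obtain ⟨w, hg, hw⟩ := exists_isWeightedPrimitive_inv_sq (Q := 1327104) hp
    (coprime_two_pow_mul_three_pow hp 14 4)
  have h := hg.eq_comb24
  rw [hw 1 1327104 (by norm_num), hw 2 331776 (by norm_num), hw 4 82944 (by norm_num),
    hw 6 36864 (by norm_num), hw 8 20736 (by norm_num), hw 12 9216 (by norm_num),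
    hw 16 5184 (by norm_num), hw 18 4096 (by norm_num), hw 32 1296 (by norm_num),
    hw 36 1024 (by norm_num), hw 48 576 (by norm_num), hw 64 324 (by norm_num),
    hw 72 256 (by norm_num), hw 128 81 (by norm_num)] at h
  have hE := eulerNumber_eq_gridIntervalSum (t := p - 3) (k := 1) (M := 1152) hodd le_rfl
    (by omega) (by omega) (by norm_num)
  have hprim : IsGridPrimitive p (-2) (gridIntervalSum p (p - 3) 4608 0) := by
    intro a b x y hxy
    rw [intervalPowerSum_neg_two hp]
    exact isGridPrimitive_gridIntervalSum (coprime_two_pow_mul_three_pow hp 9 2) a b hxy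
  rw [combinationValue_vandiverComb24 hprim]
  push_cast at h
  norm_num at hE
  linear_combination 1327104 * hE + h

theorem combinationCost_eulerComb (p t : ℕ) :
    combinationCost p (eulerComb3 t) = 3 * p / 16 ∧
    combinationCost p (eulerComb5 t) = 9 * p / 64 ∧
    combinationCost p (eulerComb9 t) = 43 * p / 384 ∧
    combinationCost p (eulerComb16 t) = 205 * p / 2304 ∧
    combinationCost p (eulerComb24 t) = 115 * p / 1536 := by
  refine ⟨?_, ?_, ?_, ?_, ?_⟩ <;>
  · simp only [combinationCost, eulerComb3, eulerComb5, eulerComb9, eulerComb16, eulerComb24,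
      List.map_cons, List.map_nil, List.sum_cons, List.sum_nil]
    ring

theorem mainTheorem3 (p : ℕ) [Fact p.Prime] (hp : 5 ≤ p) :
    (∀ k t : ℕ, 1 ≤ k → 2 * k + 3 ≤ p → (t : ℤ) = p - 1 - 2 * k →
      ((-1) ^ k * 4 ^ (2 * k - 1) * (eulerNumber t : ZMod p) =
          combinationValue p t (eulerComb3 t) ∧
        (eulerComb3 t).length = 3 ∧
        combinationCost p (eulerComb3 t) = 3 * p / 16) ∧
      ((-1) ^ k * 4 ^ (2 * k - 1) * (eulerNumber t : ZMod p) =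
          combinationValue p t (eulerComb5 t) ∧
        (eulerComb5 t).length = 5 ∧
        combinationCost p (eulerComb5 t) = 9 * p / 64) ∧
      ((-1) ^ k * 4 ^ (2 * k - 1) * (eulerNumber t : ZMod p) =
          combinationValue p t (eulerComb9 t) ∧
        (eulerComb9 t).length = 9 ∧
        combinationCost p (eulerComb9 t) = 43 * p / 384) ∧
      ((-1) ^ k * 4 ^ (2 * k - 1) * (eulerNumber t : ZMod p) =
          combinationValue p t (eulerComb16 t) ∧
        (eulerComb16 t).length = 16 ∧
        combinationCost p (eulerComb16 t) = 205 * p / 2304) ∧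
      ((-1) ^ k * 4 ^ (2 * k - 1) * (eulerNumber t : ZMod p) =
          combinationValue p t (eulerComb24 t) ∧
        (eulerComb24 t).length = 24 ∧
        combinationCost p (eulerComb24 t) = 115 * p / 1536)) ∧
    ((-64) * (eulerNumber (p - 3) : ZMod p) = combinationValue p (-2) vandiverComb3 ∧
      (-1024) * (eulerNumber (p - 3) : ZMod p) = combinationValue p (-2) vandiverComb5 ∧
      (-36864) * (eulerNumber (p - 3) : ZMod p) = combinationValue p (-2) vandiverComb9 ∧
      (-1327104) * (eulerNumber (p - 3) : ZMod p) = combinationValue p (-2) vandiverComb16 ∧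
      (-5308416) * (eulerNumber (p - 3) : ZMod p) = combinationValue p (-2) vandiverComb24) := by
  refine ⟨fun k t hk hkp ht => ?_, eulerNumber_eq_combinationValue_vandiverComb3 hp,
    eulerNumber_eq_combinationValue_vandiverComb5 hp,
    eulerNumber_eq_combinationValue_vandiverComb9 hp,
    eulerNumber_eq_combinationValue_vandiverComb16 hp,
    eulerNumber_eq_combinationValue_vandiverComb24 hp⟩
  have ht' : t + 2 * k = p - 1 := by omega
  -- The bound `2k + 3 ≤ p` gives `t ≥ 2`, which the vanishing of the half sum needs.
  have ht0 : t ≠ 0 := by omega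
  obtain ⟨h3, h5, h9, h16, h24⟩ := combinationCost_eulerComb p t
  exact ⟨⟨eulerNumber_eq_combinationValue_eulerComb3 hp hk ht' ht0, rfl, h3⟩,
    ⟨eulerNumber_eq_combinationValue_eulerComb5 hp hk ht' ht0, rfl, h5⟩,
    ⟨eulerNumber_eq_combinationValue_eulerComb9 hp hk ht' ht0, rfl, h9⟩,
    ⟨eulerNumber_eq_combinationValue_eulerComb16 hp hk ht' ht0, rfl, h16⟩,
    ⟨eulerNumber_eq_combinationValue_eulerComb24 hp hk ht' ht0, rfl, h24⟩⟩
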